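/- Let $d,n\in\mathbb N$ and $V(x)=\tfrac14|x|^4-\tfrac12|x|^2$ on $\mathbb R^d$. On a probability space let $W$ be a standard $d$-dimensional Brownian motion and, for each $\varepsilon\in(0,1)$, let $\xi_\varepsilon$ be an $\mathbb R^d$-valued random variable independent of $W$ and let $X_\varepsilon$ be a (continuous) solution of $$dX_\varepsilon(t)=-\nabla V(X_\varepsilon(t))\,dt+\sqrt{2\varepsilon}\,dW_t,\qquad X_\varepsilon(0)=\xi_\varepsilon .$$ Assume that there are random variables $\xi_0,\dots,\xi_n$ such that for all real $p\ge1$ and all $0\le k\le n$ we have $\mathbb E|\xi_k|^{2p}<\infty$ and, with a constant $C(k,p)$ independent of $\varepsilon\in(0,1)$, $$\mathbb E\Big|\xi_\varepsilon-\sum_{j=0}^k\varepsilon^{j/2}\xi_j\Big|^{2p}\le C(k,p)\,\varepsilon^{(k+1)p}.$$ For $i,m\ge1$ let $\mathcal D_i^m$ be the set of $i$-tuples of positive integers with sum $m$. Let $\bar X_0,\dots,\bar X_n$ be (continuous) solutions, with $\bar X_m(0)=\xi_m$, of $$d\bar X_0=(\bar X_0-|\bar X_0|^2\bar X_0)\,dt,\qquad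 d\bar X_1=\big[(1-|\bar X_0|^2)I-2\bar X_0\otimes\bar X_0\big]\bar X_1\,dt+\sqrt2\,dW_t,$$ and, for $2\le m\le n$, $$d\bar X_m=\big[(1-|\bar X_0|^2)I-2\bar X_0\otimes\bar X_0\big]\bar X_m\,dt-\sum_{(i,j)\in\mathcal D_2^m}\big[(\bar X_i\cdot\bar X_j)\bar X_0+2(\bar X_i\cdot\bar X_0)\bar X_j\big]dt-\sum_{(i,j,k)\in\mathcal D_3^m}(\bar X_i\cdot\bar X_j)\bar X_k\,dt .$$ For $0\le m\le n$ put $$w_{\varepsilon,m}(t)=\varepsilon^{-m/2}\Big(X_\varepsilon(t)-\sum_{k=0}^m\varepsilon^{k/2}\bar X_k(t)\Big).$$ Then for every real $p\ge1$ and every $t>0$ there is a constant $C(p,t,n)>0$, independent of $\varepsilon$, such that for all $\varepsilon\in(0,1)$ and all $m=0,\dots,n$ $$\mathbb E|w_{\varepsilon,m}(t)|^{2p}\le C(p,t,n)\,\varepsilon^p .$$ Moreover, the estimate is uniform on compact time intervals: for every real $p\ge1$ and every $T>0$ there is a constant $C(p,T,n)>0$, independent of $\varepsilon$, such that for all $\varepsilon\in(0,1)$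 and all $m=0,\dots,n$ $$\sup_{0\le t\le T}\mathbb E|w_{\varepsilon,m}(t)|^{2p}\le C(p,T,n)\,\varepsilon^p .$$ (The dimension and the data $\xi_\varepsilon,\xi_0,\dots,\xi_n$, with the constants in the assumption on them, are fixed, and the constants may depend on them.) -/

import Mathlib

open MeasureTheory ProbabilityTheory
open scoped NNReal

noncomputable section

namespace DoubleWell

/-- The state space `ℝ^d` with its Euclidean norm and inner product. -/
abbrev Space (d : ℕ) : Type := EuclideanSpace ℝ (Fin d)

/-- The potential `V(x) = |x|^4 / 4 - |x|^2 / 2`. -/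
def potential {d : ℕ} (x : Space d) : ℝ := ‖x‖ ^ 4 / 4 - ‖x‖ ^ 2 / 2

/-- A standard `d`-dimensional Brownian motion: the coordinates are standard real Brownian motions
(with almost surely continuous paths), and they are mutually independent as processes. -/
structure IsBrownianMotion {Ω : Type*} [MeasurableSpace Ω] {d : ℕ}
    (W : ℝ≥0 → Ω → Space d) (P : Measure Ω) : Prop where
  coord : ∀ i : Fin d, IsBrownianReal (fun t ω => W t ω i) P
  indep : iIndepFun (fun (i : Fin d) (ω : Ω) (t : ℝ≥0) => W t ω i) P

/-- `X` is a solution of the equation `dX(t) = b(t, X(t)) dt + σ dW(t)`, `X(0) = ξ`, with a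
(possibly random) drift `b` and a constant scalar diffusion coefficient `σ`: a stochastic process
with almost surely continuous paths which almost surely satisfies the integrated equation at all
times. The noise is additive, so its stochastic integral is `σ W(t) - σ W(0) = σ W(t)`. -/
structure IsSolution {Ω : Type*} [MeasurableSpace Ω] {d : ℕ} (P : Measure Ω)
    (W : ℝ≥0 → Ω → Space d) (σ : ℝ) (b : ℝ≥0 → Ω → Space d → Space d)
    (ξ : Ω → Space d) (X : ℝ≥0 → Ω → Space d) : Prop where
  aemeasurable : ∀ t, AEMeasurable (X t) P
  continuous_paths : ∀ᵐ ω ∂P, Continuous fun t => X t ω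
  integral_eq : ∀ᵐ ω ∂P, ∀ t : ℝ≥0,
    X t ω = ξ ω + (∫ s in (0 : ℝ)..t, b s.toNNReal ω (X s.toNNReal ω)) + σ • W t ω

/-- `X` solves `dX = -∇V(X) dt + √(2ε) dW`, `X(0) = ξ`. -/
def IsLangevinSolution {Ω : Type*} [MeasurableSpace Ω] {d : ℕ} (P : Measure Ω)
    (W : ℝ≥0 → Ω → Space d) (ε : ℝ) (ξ : Ω → Space d) (X : ℝ≥0 → Ω → Space d) : Prop :=
  IsSolution P W (Real.sqrt (2 * ε)) (fun _ _ x => -gradient potential x) ξ X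

/-- The set of `i`-tuples of positive integers with sum `m` (used for `i = 2, 3`). -/
def tuples (i m : ℕ) : Finset (Fin i → ℕ) :=
  (Finset.Nat.antidiagonalTuple i m).filter fun j => ∀ k, 0 < j k

/-- The linearised drift `[(1 - |x|^2) I - 2 x ⊗ x] y`. -/
def linearDrift {d : ℕ} (x y : Space d) : Space d :=
  (1 - ‖x‖ ^ 2) • y - (2 * inner ℝ x y) • x

/-- The forcing of order `m` at given values `x i` of the coefficients:
`- ∑_{(i,j)} [(x_i · x_j) x_0 + 2 (x_i · x_0) x_j] - ∑_{(i,j,k)} (x_i · x_j) x_k`,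
over the pairs and triples of positive integers with sum `m`. -/
def forcing {d : ℕ} (m : ℕ) (x : ℕ → Space d) : Space d :=
  -(∑ j ∈ tuples 2 m,
      ((inner ℝ (x (j 0)) (x (j 1)) : ℝ) • x 0 +
        (2 * inner ℝ (x (j 0)) (x 0) : ℝ) • x (j 1)))
    - ∑ j ∈ tuples 3 m, (inner ℝ (x (j 0)) (x (j 1)) : ℝ) • x (j 2)

/-- `(Xbar m)`, `0 ≤ m ≤ n`, solve the recursive fluctuation equations with initial data `ξ m`. -/
structure IsFluctuationSystem {Ω : Type*} [MeasurableSpace Ω] {d : ℕ} (P : Measure Ω)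
    (W : ℝ≥0 → Ω → Space d) (n : ℕ) (ξ : ℕ → Ω → Space d)
    (Xbar : ℕ → ℝ≥0 → Ω → Space d) : Prop where
  /-- `dX̄_0 = (X̄_0 - |X̄_0|^2 X̄_0) dt`. -/
  order_zero : IsSolution P W 0 (fun _ _ x => x - ‖x‖ ^ 2 • x) (ξ 0) (Xbar 0)
  /-- `dX̄_1 = [(1 - |X̄_0|^2) I - 2 X̄_0 ⊗ X̄_0] X̄_1 dt + √2 dW`. -/
  order_one : 1 ≤ n →
    IsSolution P W (Real.sqrt 2) (fun t ω y => linearDrift (Xbar 0 t ω) y) (ξ 1) (Xbar 1)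
  /-- The linear equation with forcing by the lower orders, for `m ≥ 2`. -/
  order_ge_two : ∀ m, 2 ≤ m → m ≤ n →
    IsSolution P W 0
      (fun t ω y => linearDrift (Xbar 0 t ω) y + forcing m (fun i => Xbar i t ω)) (ξ m) (Xbar m)

/-- The truncated expansion `∑_{k ≤ m} ε^{k/2} x_k`. -/
def partialSum {d : ℕ} (ε : ℝ) (m : ℕ) (x : ℕ → Space d) : Space d :=
  ∑ k ∈ Finset.range (m + 1), ε ^ ((k : ℝ) / 2) • x k

/-- The moment bound `E|Y|^q ≤ B`, finiteness of the expectation being part of it. -/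
def MomentLE {Ω : Type*} [MeasurableSpace Ω] {d : ℕ} (P : Measure Ω) (Y : Ω → Space d)
    (q B : ℝ) : Prop :=
  Integrable (fun ω => ‖Y ω‖ ^ q) P ∧ ∫ ω, ‖Y ω‖ ^ q ∂P ≤ B

/-- The family `ξε` (`0 < ε < 1`) of initial data has the expansion
`ξε = ξ 0 + ε^{1/2} ξ 1 + ⋯ + ε^{n/2} ξ n + o(ε^{n/2})` in all `L^{2p}`, `p ≥ 1`. -/
structure InitialExpansion {Ω : Type*} [MeasurableSpace Ω] {d : ℕ} (P : Measure Ω) (n : ℕ)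
    (ξε : ℝ → Ω → Space d) (ξ : ℕ → Ω → Space d) : Prop where
  aemeasurable : ∀ k ≤ n, AEMeasurable (ξ k) P
  moments : ∀ k ≤ n, ∀ p : ℝ, 1 ≤ p → Integrable (fun ω => ‖ξ k ω‖ ^ (2 * p)) P
  remainder : ∀ k ≤ n, ∀ p : ℝ, 1 ≤ p → ∃ C : ℝ, ∀ ε ∈ Set.Ioo (0 : ℝ) 1,
    MomentLE P (fun ω => ξε ε ω - partialSum ε k (fun j => ξ j ω)) (2 * p)
      (C * ε ^ (((k : ℝ) + 1) * p))

/-- The remainder `w_{ε,m}(t) = (X_ε(t) - ∑_{k ≤ m} ε^{k/2} X̄_k(t)) / ε^{m/2}`. -/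
def remainder {Ω : Type*} {d : ℕ} (X : ℝ → ℝ≥0 → Ω → Space d)
    (Xbar : ℕ → ℝ≥0 → Ω → Space d) (ε : ℝ) (m : ℕ) (t : ℝ≥0) (ω : Ω) : Space d :=
  (ε ^ ((m : ℝ) / 2))⁻¹ • (X ε t ω - partialSum ε m (fun k => Xbar k t ω))

end DoubleWell

end

noncomputable section

namespace DoubleWell

/-! Write `δ = √ε` and `S = ∑_{k ≤ m} δ^k X̄_k`. The coefficient equations are what results from
inserting a power series in `δ` into the equation of `X_ε` and comparing powers. Hence `S` solves
that equation up to a drift defect consisting of the cubic terms of total degree above `m`, bounded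
by `δ^(m+1) (∑ |X̄_k|)^3` (`norm_drift_sum_sub_le`). The noise is additive. For `m ≥ 1` it cancels
in `X_ε - S`; for `m = 0` it is subtracted by hand, which costs only a term of order `δ`. The
difference `u` then solves an integral equation path by path. The drift is one-sided Lipschitz with
constant 1 (`inner_drift_add_sub_le`), so the cubic nonlinearity needs no control in `u`:
`inner_drift_sub_le` gives `⟨u, u'⟩ ≤ |u|^2 + |u| δ^(m+1) H` with `H` a polynomial in `|W|` and the
`|X̄_k|`. In particular no moments of `X_ε` enter. A pathwise Gronwall estimate for `|u|^q` followed
by Tonelli (`lintegral_enorm_rpow_le_of_inner_le`) reduces the claim to moments of `u(0)`, which are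
assumed small, and of `H`. The latter follow from Gaussian moments of `W` and the same Gronwall
estimate applied recursively to the `X̄_k` (`IsFluctuationSystem.hasMomentBounds`). -/

/-! ### Pathwise Gronwall estimate. -/

/-- Gronwall's inequality for the powers of the norm of a curve with a one-sided bound on its
velocity. -/
lemma norm_rpow_le_of_inner_le {E : Type*} [NormedAddCommGroup E] [InnerProductSpace ℝ E]
    [CompleteSpace E] {u g : ℝ → E} {u₀ : E} {h : ℝ → ℝ} {q : ℝ} (hq : 2 ≤ q)
    (hg : Continuous g) (hh : Continuous h)
    (hu : ∀ t, 0 ≤ t → u t = u₀ + ∫ s in (0 : ℝ)..t, g s)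
    (hin : ∀ t, 0 ≤ t → inner ℝ (u t) (g t) ≤ ‖u t‖ ^ 2 + ‖u t‖ * ‖h t‖) {t : ℝ} (ht : 0 ≤ t) :
    ‖u t‖ ^ q ≤ Real.exp (2 * q * t) * (‖u₀‖ ^ q + q * ∫ s in (0 : ℝ)..t, ‖h s‖ ^ q) := by
  have hq0 : 0 < q := by linarith
  -- The integral equation controls `u` only at nonnegative times; `v` extends it to a curve
  -- differentiable on the whole line.
  set v : ℝ → E := fun t => u₀ + ∫ s in (0 : ℝ)..t, g s with hv
  have hvd : ∀ t, HasDerivAt v (g t) t := fun t =>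
    (intervalIntegral.integral_hasDerivAt_right (hg.intervalIntegrable _ _)
      (hg.stronglyMeasurableAtFilter _ _) hg.continuousAt).const_add u₀
  -- Since `q / 2 ≥ 1`, this power of the squared norm is differentiable even where the curve
  -- vanishes.
  have hφ : ∀ t, HasDerivAt (fun t => (‖v t‖ ^ 2) ^ (q / 2))
      (2 * inner ℝ (v t) (g t) * (q / 2) * (‖v t‖ ^ 2) ^ (q / 2 - 1)) t := fun t =>
    (hvd t).norm_sq.rpow_const (Or.inr (by linarith))
  have hhq : Continuous fun s => ‖h s‖ ^ q :=
    hh.norm.rpow_const fun _ => Or.inr hq0.le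
  have hI : ∀ t, HasDerivAt (fun t => ∫ s in (0 : ℝ)..t, ‖h s‖ ^ q) (‖h t‖ ^ q) t := fun t =>
    intervalIntegral.integral_hasDerivAt_right (hhq.intervalIntegrable _ _)
      (hhq.stronglyMeasurableAtFilter _ _) hhq.continuousAt
  have hexp : ∀ t, HasDerivAt (fun t => Real.exp (-(2 * q * t)))
      (Real.exp (-(2 * q * t)) * -(2 * q)) t := fun t => by
    simpa using (((hasDerivAt_id t).const_mul (2 * q)).neg).exp
  -- The rate `2 * q` absorbs the term `2 * a ^ q` of `key` below; the forcing integral can be left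
  -- unweighted because the exponential is at most 1.
  set ψ : ℝ → ℝ := fun t => Real.exp (-(2 * q * t)) * (‖v t‖ ^ 2) ^ (q / 2) -
    q * ∫ s in (0 : ℝ)..t, ‖h s‖ ^ q with hψ
  have hψd := fun t => ((hexp t).mul (hφ t)).sub ((hI t).const_mul q)
  have hanti : AntitoneOn ψ (Set.Ici 0) := by
    refine antitoneOn_of_hasDerivWithinAt_nonpos (convex_Ici 0)
      (fun t _ => (hψd t).continuousAt.continuousWithinAt)
      (fun t _ => (hψd t).hasDerivWithinAt) fun t ht => ?_
    rw [interior_Ici] at ht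
    have ht0 : 0 ≤ t := le_of_lt ht
    have hin' := hin t ht0
    rw [hu t ht0] at hin'
    change inner ℝ (v t) (g t) ≤ ‖v t‖ ^ 2 + ‖v t‖ * ‖h t‖ at hin'
    set a := ‖v t‖ with ha
    set b := ‖h t‖ with hb
    have ha0 : 0 ≤ a := norm_nonneg _
    have hb0 : 0 ≤ b := norm_nonneg _
    have e1 : (a ^ 2) ^ (q / 2) = a ^ q := by
      rw [← Real.rpow_natCast, ← Real.rpow_mul ha0]; congr 1; push_cast; ring
    have e2 : (a ^ 2) ^ (q / 2 - 1) = a ^ (q - 2) := by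
      rw [← Real.rpow_natCast, ← Real.rpow_mul ha0]; congr 1; push_cast; ring
    have hle1 : Real.exp (-(2 * q * t)) ≤ 1 := by
      rw [Real.exp_le_one_iff]; nlinarith
    have key : inner ℝ (v t) (g t) * a ^ (q - 2) ≤ 2 * a ^ q + b ^ q := by
      rcases ha0.eq_or_lt with h0 | h0
      · have : v t = 0 := by rw [← norm_eq_zero, ← ha, ← h0]
        rw [this, inner_zero_left, zero_mul]
        positivity
      · have f1 : a ^ 2 * a ^ (q - 2) = a ^ q := by
          rw [← Real.rpow_natCast a 2, ← Real.rpow_add h0]; congr 1; push_cast; ring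
        have f2 : a * a ^ (q - 2) = a ^ (q - 1) := by
          rw [← Real.rpow_one_add' ha0 (by linarith)]; congr 1; ring
        have f3 : a ^ (q - 1) * b ≤ a ^ q + b ^ q := by
          rcases le_total a b with hab | hab
          · have : a ^ (q - 1) * b ≤ b ^ (q - 1) * b := by gcongr; linarith
            have e : b ^ (q - 1) * b = b ^ q := by
              rw [← Real.rpow_add_one' hb0 (by linarith)]; congr 1; ring
            have : 0 ≤ a ^ q := by positivity
            linarith
          · have : a ^ (q - 1) * b ≤ a ^ (q - 1) * a := by gcongr
            have e : a ^ (q - 1) * a = a ^ q := by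
              rw [← Real.rpow_add_one' ha0 (by linarith)]; congr 1; ring
            have : 0 ≤ b ^ q := by positivity
            linarith
        calc inner ℝ (v t) (g t) * a ^ (q - 2) ≤ (a ^ 2 + a * b) * a ^ (q - 2) := by gcongr
          _ = a ^ 2 * a ^ (q - 2) + a * a ^ (q - 2) * b := by ring
          _ ≤ 2 * a ^ q + b ^ q := by rw [f1, f2]; linarith
    rw [e1, e2]
    have hbq : 0 ≤ b ^ q := by positivity
    have h1 : Real.exp (-(2 * q * t)) * (q * (inner ℝ (v t) (g t) * a ^ (q - 2)) -
        q * (2 * a ^ q)) ≤ Real.exp (-(2 * q * t)) * (q * b ^ q) := by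
      refine mul_le_mul_of_nonneg_left ?_ (Real.exp_pos _).le
      rw [← mul_sub]
      exact mul_le_mul_of_nonneg_left (by linarith) hq0.le
    have h2 : Real.exp (-(2 * q * t)) * (q * b ^ q) ≤ q * b ^ q :=
      mul_le_of_le_one_left (by positivity) hle1
    linarith
  have h0 := hanti (Set.mem_Ici.2 le_rfl) (Set.mem_Ici.2 ht) ht
  have hpow : ∀ x : E, (‖x‖ ^ 2) ^ (q / 2) = ‖x‖ ^ q := fun x => by
    rw [← Real.rpow_natCast, ← Real.rpow_mul (norm_nonneg _)]; congr 1; push_cast; ring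
  simp only [hψ, hpow, hv, intervalIntegral.integral_same, mul_zero, neg_zero, Real.exp_zero,
    add_zero, one_mul, sub_zero] at h0
  rw [← hu t ht] at h0
  have : ‖u t‖ ^ q = Real.exp (2 * q * t) * (Real.exp (-(2 * q * t)) * ‖u t‖ ^ q) := by
    rw [← mul_assoc, ← Real.exp_add, add_neg_cancel, Real.exp_zero, one_mul]
  rw [this]
  gcongr
  linarith

/-! ### Tonelli for continuous processes, and the calculus of moment bounds. -/

section Processes

variable {Ω : Type*} [MeasurableSpace Ω] {P : Measure Ω}
  {E : Type*} [NormedAddCommGroup E] [MeasurableSpace E] [BorelSpace E]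

/-- A process which is measurable at each time and has almost surely continuous paths is
indistinguishable from a jointly measurable process. -/
lemma exists_measurable_uncurry [SecondCountableTopology E] {H : ℝ≥0 → Ω → E}
    (hm : ∀ t, AEMeasurable (H t) P) (hc : ∀ᵐ ω ∂P, Continuous fun t => H t ω) :
    ∃ K : ℝ≥0 → Ω → E, Measurable (Function.uncurry K) ∧ ∀ᵐ ω ∂P, ∀ t, K t ω = H t ω := by
  obtain ⟨S, hSc, hSd⟩ := TopologicalSpace.exists_countable_dense ℝ≥0
  have : Countable S := hSc.to_subtype
  have hall : ∀ᵐ ω ∂P, (Continuous fun t => H t ω) ∧ ∀ s : S, H s ω = (hm s).mk _ ω :=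
    hc.and (ae_all_iff.2 fun s => (hm s).ae_eq_mk)
  obtain ⟨N, hNsub, hNm, hN0⟩ := exists_measurable_superset_of_null (ae_iff.1 hall)
  have hgood : ∀ ω ∉ N, (Continuous fun t => H t ω) ∧ ∀ s : S, H s ω = (hm s).mk _ ω :=
    fun ω hω => by
      by_contra h
      exact hω (hNsub h)
  -- Killing the process on the null set `N` makes every path continuous and the values at the dense
  -- times `S` measurable. Limits along `S` give measurability at all times, and continuity then
  -- gives joint measurability.
  refine ⟨fun t => Nᶜ.indicator (H t), ?_, ?_⟩
  · have hS : ∀ s : S, Measurable (Nᶜ.indicator (H s)) := fun s => by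
      have : Nᶜ.indicator (H s) = Nᶜ.indicator ((hm s).mk _) :=
        Set.indicator_congr fun ω hω => (hgood ω hω).2 s
      rw [this]
      exact (hm s).measurable_mk.indicator hNm.compl
    have hcont : ∀ ω, Continuous fun t => Nᶜ.indicator (H t) ω := fun ω => by
      by_cases hω : ω ∈ N
      · simpa [hω] using continuous_const
      · simpa [hω] using (hgood ω hω).1
    have hmeas : ∀ t, Measurable (Nᶜ.indicator (H t)) := fun t => by
      obtain ⟨x, hxS, hx⟩ := mem_closure_iff_seq_limit.1 (hSd t)
      refine measurable_of_tendsto_metrizable (fun k => hS ⟨x k, hxS k⟩) ?_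
      exact tendsto_pi_nhds.2 fun ω => ((hcont ω).tendsto t).comp hx
    exact (measurable_uncurry_of_continuous_of_measurable hcont hmeas)
  · have : ∀ᵐ ω ∂P, ω ∉ N := measure_eq_zero_iff_ae_notMem.1 hN0
    filter_upwards [this] with ω hω t
    simp [hω]

lemma enorm_rpow_eq_ofReal {F : Type*} [NormedAddCommGroup F] (x : F) {q : ℝ} (hq : 0 ≤ q) :
    ‖x‖ₑ ^ q = ENNReal.ofReal (‖x‖ ^ q) := by
  rw [← ofReal_norm, ENNReal.ofReal_rpow_of_nonneg (norm_nonneg _) hq]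

/-- Tonelli, applied to the jointly measurable version `K` because `H` itself is only measurable at
fixed times. -/
lemma lintegral_lintegral_enorm_rpow_le [IsProbabilityMeasure P] [SecondCountableTopology E]
    {H : ℝ≥0 → Ω → E} (hm : ∀ t, AEMeasurable (H t) P)
    (hc : ∀ᵐ ω ∂P, Continuous fun t => H t ω) {q : ℝ} {t : ℝ≥0} {B : ENNReal}
    (hB : ∀ s ≤ t, ∫⁻ ω, ‖H s ω‖ₑ ^ q ∂P ≤ B) :
    ∫⁻ ω, (∫⁻ s in Set.Ioc (0 : ℝ) t, ‖H s.toNNReal ω‖ₑ ^ q) ∂P ≤ t * B := by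
  obtain ⟨K, hK, hKH⟩ := exists_measurable_uncurry hm hc
  have hKq : Measurable fun z : Ω × ℝ => ‖K z.2.toNNReal z.1‖ₑ ^ q :=
    (hK.comp ((measurable_real_toNNReal.comp measurable_snd).prodMk
      measurable_fst)).enorm.pow_const q
  calc ∫⁻ ω, (∫⁻ s in Set.Ioc (0 : ℝ) t, ‖H s.toNNReal ω‖ₑ ^ q) ∂P
      = ∫⁻ ω, (∫⁻ s in Set.Ioc (0 : ℝ) t, ‖K s.toNNReal ω‖ₑ ^ q) ∂P := by
        refine lintegral_congr_ae ?_
        filter_upwards [hKH] with ω hω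
        simp only [hω]
    _ = ∫⁻ s in Set.Ioc (0 : ℝ) t, ∫⁻ ω, ‖K s.toNNReal ω‖ₑ ^ q ∂P :=
        lintegral_lintegral_swap hKq.aemeasurable
    _ ≤ ∫⁻ _ in Set.Ioc (0 : ℝ) t, B := by
        refine setLIntegral_mono' measurableSet_Ioc fun s hs => ?_
        refine le_trans (le_of_eq (lintegral_congr_ae ?_))
          (hB s.toNNReal (Real.toNNReal_le_iff_le_coe.2 hs.2))
        filter_upwards [hKH] with ω hω
        simp only [hω]
    _ = t * B := by
        rw [setLIntegral_const, Real.volume_Ioc, sub_zero, ENNReal.ofReal_coe_nnreal, mul_comm]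

/-- Moment form of `norm_rpow_le_of_inner_le`. -/
lemma lintegral_enorm_rpow_le_of_inner_le [IsProbabilityMeasure P] [InnerProductSpace ℝ E]
    [CompleteSpace E] {u : ℝ≥0 → Ω → E} {u₀ : Ω → E} {H : ℝ≥0 → Ω → ℝ}
    (hu₀ : AEMeasurable u₀ P) (hm : ∀ t, AEMeasurable (H t) P)
    (hc : ∀ᵐ ω ∂P, Continuous fun t => H t ω)
    (hpath : ∀ᵐ ω ∂P, ∃ g : ℝ≥0 → E, Continuous g ∧
      (∀ t : ℝ≥0, u t ω = u₀ ω + ∫ s in (0 : ℝ)..t, g s.toNNReal) ∧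
      ∀ t, inner ℝ (u t ω) (g t) ≤ ‖u t ω‖ ^ 2 + ‖u t ω‖ * ‖H t ω‖)
    {q : ℝ} (hq : 2 ≤ q) {T : ℝ≥0} {A B : ENNReal}
    (hA : ∫⁻ ω, ‖u₀ ω‖ₑ ^ q ∂P ≤ A) (hB : ∀ s ≤ T, ∫⁻ ω, ‖H s ω‖ₑ ^ q ∂P ≤ B)
    {t : ℝ≥0} (ht : t ≤ T) :
    ∫⁻ ω, ‖u t ω‖ₑ ^ q ∂P ≤
      ENNReal.ofReal (Real.exp (2 * q * T)) * (A + ENNReal.ofReal q * (T * B)) := by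
  have hq0 : 0 ≤ q := by linarith
  have hpt : ∀ᵐ ω ∂P, ‖u t ω‖ₑ ^ q ≤ ENNReal.ofReal (Real.exp (2 * q * T)) * (‖u₀ ω‖ₑ ^ q +
      ENNReal.ofReal q * ∫⁻ s in Set.Ioc (0 : ℝ) t, ‖H s.toNNReal ω‖ₑ ^ q) := by
    filter_upwards [hpath, hc] with ω ⟨g, hg, hug, hin⟩ hcω
    have hcont : Continuous fun s : ℝ => H s.toNNReal ω := hcω.comp continuous_real_toNNReal
    have hmain := norm_rpow_le_of_inner_le (u := fun s => u s.toNNReal ω)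
      (g := fun s => g s.toNNReal) (u₀ := u₀ ω) (h := fun s => H s.toNNReal ω) hq
      (hg.comp continuous_real_toNNReal) hcont
      (fun s hs => by
        have := hug s.toNNReal
        rwa [Real.coe_toNNReal s hs] at this) (fun s _ => hin _) t.coe_nonneg
    simp only [Real.toNNReal_coe] at hmain
    have hhq : Continuous fun s : ℝ => ‖H s.toNNReal ω‖ ^ q :=
      hcont.norm.rpow_const fun _ => Or.inr hq0
    have hint : ENNReal.ofReal (∫ s in (0 : ℝ)..t, ‖H s.toNNReal ω‖ ^ q) =
        ∫⁻ s in Set.Ioc (0 : ℝ) t, ‖H s.toNNReal ω‖ₑ ^ q := by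
      rw [intervalIntegral.integral_of_le t.coe_nonneg,
        ofReal_integral_eq_lintegral_ofReal (hhq.integrableOn_Ioc)
          (Filter.Eventually.of_forall fun s => by positivity)]
      simp only [enorm_rpow_eq_ofReal _ hq0]
    have hI0 : 0 ≤ ∫ s in (0 : ℝ)..t, ‖H s.toNNReal ω‖ ^ q :=
      intervalIntegral.integral_nonneg t.coe_nonneg fun s _ => by positivity
    rw [← hint, enorm_rpow_eq_ofReal _ hq0, enorm_rpow_eq_ofReal _ hq0, ← ENNReal.ofReal_mul hq0,
      ← ENNReal.ofReal_add (by positivity) (by positivity), ← ENNReal.ofReal_mul (by positivity)]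
    refine ENNReal.ofReal_le_ofReal (hmain.trans ?_)
    have : (t : ℝ) ≤ T := ht
    gcongr
  calc ∫⁻ ω, ‖u t ω‖ₑ ^ q ∂P ≤ _ := lintegral_mono_ae hpt
    _ = ENNReal.ofReal (Real.exp (2 * q * T)) * ((∫⁻ ω, ‖u₀ ω‖ₑ ^ q ∂P) + ENNReal.ofReal q *
        ∫⁻ ω, (∫⁻ s in Set.Ioc (0 : ℝ) t, ‖H s.toNNReal ω‖ₑ ^ q) ∂P) := by
      rw [lintegral_const_mul' _ _ ENNReal.ofReal_ne_top,
        lintegral_add_left' (hu₀.enorm.pow_const q),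
        lintegral_const_mul' _ _ ENNReal.ofReal_ne_top]
    _ ≤ _ := by
      gcongr
      refine (lintegral_lintegral_enorm_rpow_le hm hc fun s hs => hB s (hs.trans ht)).trans ?_
      gcongr

/-- A process with almost surely continuous paths all of whose moments of order at least two are
bounded on compact time intervals. -/
structure HasMomentBounds (P : Measure Ω) (H : ℝ≥0 → Ω → E) : Prop where
  aemeasurable : ∀ t, AEMeasurable (H t) P
  continuous_paths : ∀ᵐ ω ∂P, Continuous fun t => H t ω
  moments : ∀ q : ℝ, 2 ≤ q → ∀ T : ℝ≥0, ∃ C : ℝ≥0, ∀ t ≤ T, ∫⁻ ω, ‖H t ω‖ₑ ^ q ∂P ≤ C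

namespace HasMomentBounds

variable {F : Type*} [NormedAddCommGroup F] [MeasurableSpace F] [BorelSpace F]

omit [BorelSpace E] [BorelSpace F] in
lemma of_norm_le {H : ℝ≥0 → Ω → E} {K : ℝ≥0 → Ω → F} (hK : HasMomentBounds P K)
    (hm : ∀ t, AEMeasurable (H t) P) (hc : ∀ᵐ ω ∂P, Continuous fun t => H t ω)
    (hle : ∀ t ω, ‖H t ω‖ ≤ ‖K t ω‖) : HasMomentBounds P H := by
  refine ⟨hm, hc, fun q hq T => ?_⟩
  obtain ⟨C, hC⟩ := hK.moments q hq T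
  refine ⟨C, fun t ht => le_trans (lintegral_mono fun ω => ?_) (hC t ht)⟩
  have : ‖H t ω‖ₑ ≤ ‖K t ω‖ₑ := enorm_le_iff_norm_le.2 (hle t ω)
  exact ENNReal.rpow_le_rpow this (by linarith)

lemma norm {H : ℝ≥0 → Ω → E} (hH : HasMomentBounds P H) :
    HasMomentBounds P fun t ω => ‖H t ω‖ :=
  hH.of_norm_le (fun t => (hH.aemeasurable t).norm)
    (hH.continuous_paths.mono fun _ h => h.norm) fun t ω => by simp

omit [BorelSpace E] in
lemma const [IsProbabilityMeasure P] (c : E) : HasMomentBounds P fun (_ : ℝ≥0) (_ : Ω) => c := by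
  refine ⟨fun t => aemeasurable_const, Filter.Eventually.of_forall fun _ => continuous_const,
    fun q hq T => ⟨‖c‖₊ ^ q, fun t _ => ?_⟩⟩
  rw [lintegral_const, measure_univ, mul_one, ENNReal.coe_rpow_of_nonneg _ (by linarith)]
  rfl

lemma add [SecondCountableTopology E] {H K : ℝ≥0 → Ω → E} (hH : HasMomentBounds P H)
    (hK : HasMomentBounds P K) : HasMomentBounds P fun t ω => H t ω + K t ω := by
  refine ⟨fun t => (hH.aemeasurable t).add (hK.aemeasurable t),
    (hH.continuous_paths.and hK.continuous_paths).mono fun _ h => h.1.add h.2, fun q hq T => ?_⟩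
  obtain ⟨A, hA⟩ := hH.moments q hq T
  obtain ⟨B, hB⟩ := hK.moments q hq T
  refine ⟨2 ^ (q - 1) * (A + B), fun t ht => ?_⟩
  have hpt : ∀ ω, ‖H t ω + K t ω‖ₑ ^ q ≤
      (2 : ENNReal) ^ (q - 1) * (‖H t ω‖ₑ ^ q + ‖K t ω‖ₑ ^ q) := fun ω =>
    (ENNReal.rpow_le_rpow (enorm_add_le _ _) (by linarith)).trans
      (ENNReal.rpow_add_le_mul_rpow_add_rpow _ _ (by linarith))
  have h2 : (2 : ENNReal) ^ (q - 1) ≠ ⊤ := ENNReal.rpow_ne_top_of_nonneg (by linarith) (by simp)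
  calc ∫⁻ ω, ‖H t ω + K t ω‖ₑ ^ q ∂P ≤ _ := lintegral_mono hpt
    _ = (2 : ENNReal) ^ (q - 1) *
        ((∫⁻ ω, ‖H t ω‖ₑ ^ q ∂P) + ∫⁻ ω, ‖K t ω‖ₑ ^ q ∂P) := by
      rw [lintegral_const_mul' _ _ h2, lintegral_add_left' ((hH.aemeasurable t).enorm.pow_const q)]
    _ ≤ (2 : ENNReal) ^ (q - 1) * (A + B) := by gcongr <;> solve_by_elim
    _ = _ := by
      push_cast
      rw [ENNReal.coe_rpow_of_nonneg _ (by linarith)]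
      rfl

/-- By `ab ≤ a^2 + b^2`, at the price of doubling the exponent. This is why `HasMomentBounds` asks
for all exponents at once. -/
lemma mul {H K : ℝ≥0 → Ω → ℝ} (hH : HasMomentBounds P H) (hK : HasMomentBounds P K) :
    HasMomentBounds P fun t ω => H t ω * K t ω := by
  refine ⟨fun t => (hH.aemeasurable t).mul (hK.aemeasurable t),
    (hH.continuous_paths.and hK.continuous_paths).mono fun _ h => h.1.mul h.2, fun q hq T => ?_⟩
  obtain ⟨A, hA⟩ := hH.moments (2 * q) (by linarith) T
  obtain ⟨B, hB⟩ := hK.moments (2 * q) (by linarith) T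
  refine ⟨A + B, fun t ht => ?_⟩
  have hpt : ∀ ω, ‖H t ω * K t ω‖ₑ ^ q ≤ ‖H t ω‖ₑ ^ (2 * q) + ‖K t ω‖ₑ ^ (2 * q) := fun ω => by
    rw [enorm_mul, ENNReal.mul_rpow_of_nonneg _ _ (by linarith), two_mul,
      ENNReal.rpow_add_of_nonneg _ _ (by linarith) (by linarith),
      ENNReal.rpow_add_of_nonneg _ _ (by linarith) (by linarith)]
    rcases le_total (‖H t ω‖ₑ ^ q) (‖K t ω‖ₑ ^ q) with h | h
    · exact le_add_left (by gcongr)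
    · exact le_add_right (by gcongr)
  calc ∫⁻ ω, ‖H t ω * K t ω‖ₑ ^ q ∂P ≤ _ := lintegral_mono hpt
    _ = (∫⁻ ω, ‖H t ω‖ₑ ^ (2 * q) ∂P) + ∫⁻ ω, ‖K t ω‖ₑ ^ (2 * q) ∂P :=
      lintegral_add_left' ((hH.aemeasurable t).enorm.pow_const _) _
    _ ≤ A + B := by gcongr <;> solve_by_elim
    _ = _ := by push_cast; rfl

lemma sum [IsProbabilityMeasure P] [SecondCountableTopology E] {ι : Type*} (s : Finset ι)
    {H : ι → ℝ≥0 → Ω → E} (hH : ∀ i ∈ s, HasMomentBounds P (H i)) :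
    HasMomentBounds P fun t ω => ∑ i ∈ s, H i t ω := by
  classical
  induction s using Finset.induction_on with
  | empty => simpa using const (P := P) (0 : E)
  | insert a s ha ih =>
    simp only [Finset.sum_insert ha]
    exact (hH a (by simp)).add (ih fun i hi => hH i (by simp [hi]))

lemma const_smul [IsProbabilityMeasure P] [NormedSpace ℝ E] [SecondCountableTopology E] (c : ℝ)
    {H : ℝ≥0 → Ω → E} (hH : HasMomentBounds P H) : HasMomentBounds P fun t ω => c • H t ω :=
  ((const c).mul hH.norm).of_norm_le (fun t => (hH.aemeasurable t).const_smul c)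
    (hH.continuous_paths.mono fun _ h => h.const_smul c) fun t ω => by simp [norm_smul]

end HasMomentBounds

/-- A curve with a one-sided bound on its velocity inherits moment bounds from its initial value
and from the bound. -/
lemma HasMomentBounds.of_inner_le [IsProbabilityMeasure P] [InnerProductSpace ℝ E]
    [CompleteSpace E] {u : ℝ≥0 → Ω → E} {u₀ : Ω → E} {H : ℝ≥0 → Ω → ℝ}
    (hum : ∀ t, AEMeasurable (u t) P) (huc : ∀ᵐ ω ∂P, Continuous fun t => u t ω)
    (hu₀ : AEMeasurable u₀ P) (hmom : ∀ q : ℝ, 2 ≤ q → ∫⁻ ω, ‖u₀ ω‖ₑ ^ q ∂P < ⊤)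
    (hH : HasMomentBounds P H)
    (hpath : ∀ᵐ ω ∂P, ∃ g : ℝ≥0 → E, Continuous g ∧
      (∀ t : ℝ≥0, u t ω = u₀ ω + ∫ s in (0 : ℝ)..t, g s.toNNReal) ∧
      ∀ t, inner ℝ (u t ω) (g t) ≤ ‖u t ω‖ ^ 2 + ‖u t ω‖ * ‖H t ω‖) : HasMomentBounds P u := by
  refine ⟨hum, huc, fun q hq T => ?_⟩
  obtain ⟨B, hB⟩ := hH.moments q hq T
  refine ⟨_, fun t ht => (lintegral_enorm_rpow_le_of_inner_le hu₀ hH.aemeasurable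
    hH.continuous_paths hpath hq le_rfl hB ht).trans (ENNReal.coe_toNNReal ?_).ge⟩
  have := (hmom q hq).ne
  finiteness

end Processes

/-! ### Moments of Brownian motion and of equations with additive noise. -/

section Processes

variable {Ω : Type*} [MeasurableSpace Ω] {P : Measure Ω}

namespace HasMomentBounds

lemma smul {E : Type*} [NormedAddCommGroup E] [MeasurableSpace E] [BorelSpace E]
    [NormedSpace ℝ E] [SecondCountableTopology E] {f : ℝ≥0 → Ω → ℝ}
    {H : ℝ≥0 → Ω → E} (hf : HasMomentBounds P f) (hH : HasMomentBounds P H) :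
    HasMomentBounds P fun t ω => f t ω • H t ω :=
  (hf.mul hH.norm).of_norm_le (fun t => (hf.aemeasurable t).smul (hH.aemeasurable t))
    ((hf.continuous_paths.and hH.continuous_paths).mono fun _ h => h.1.smul h.2)
    fun t ω => by simp [norm_smul]

lemma inner {E : Type*} [NormedAddCommGroup E] [MeasurableSpace E] [BorelSpace E]
    [InnerProductSpace ℝ E] [SecondCountableTopology E] {H K : ℝ≥0 → Ω → E}
    (hH : HasMomentBounds P H) (hK : HasMomentBounds P K) :
    HasMomentBounds P fun t ω => (inner ℝ (H t ω) (K t ω) : ℝ) :=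
  (hH.norm.mul hK.norm).of_norm_le
    (fun t => (hH.aemeasurable t).inner (hK.aemeasurable t))
    ((hH.continuous_paths.and hK.continuous_paths).mono fun _ h => h.1.inner h.2)
    fun t ω => by simpa using norm_inner_le_norm (𝕜 := ℝ) (H t ω) (K t ω)

end HasMomentBounds

lemma hasMomentBounds_of_isBrownianReal {B : ℝ≥0 → Ω → ℝ} (hB : IsBrownianReal B P) :
    HasMomentBounds P B := by
  refine ⟨hB.toIsPreBrownianReal.aemeasurable, hB.cont, fun q hq T => ?_⟩
  have hq0 : 0 ≤ q := by linarith
  have hfin : ∫⁻ x, ‖x‖ₑ ^ q ∂(gaussianReal 0 1) ≠ ⊤ := by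
    have := (memLp_id_gaussianReal (μ := 0) (v := 1) q.toNNReal).eLpNorm_lt_top
    have h2 := lintegral_rpow_enorm_lt_top_of_eLpNorm_lt_top
      (by simpa using (by linarith : 0 < q)) (by simp) this
    simpa [hq0] using h2.ne
  -- Brownian scaling: the value at time `t` has the law of `√t` times a standard Gaussian, and `√t
  -- ≤ √T`.
  refine ⟨((T.sqrt : ℝ≥0) ^ q) * (∫⁻ x, ‖x‖ₑ ^ q ∂(gaussianReal 0 1)).toNNReal, fun t ht => ?_⟩
  have hlaw := hB.toIsPreBrownianReal.hasLaw_eval t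
  have hmap : gaussianReal 0 t = (gaussianReal 0 1).map (fun x => (NNReal.sqrt t : ℝ) * x) := by
    rw [gaussianReal_map_const_mul]
    congr 1
    · simp
    · ext; simp
  have hmeas : Measurable fun x : ℝ => ‖x‖ₑ ^ q := by fun_prop
  have h1 : ∫⁻ ω, ‖B t ω‖ₑ ^ q ∂P = ∫⁻ x, ‖x‖ₑ ^ q ∂(gaussianReal 0 t) := by
    rw [← hlaw.map_eq, lintegral_map' hmeas.aemeasurable hlaw.aemeasurable]
  rw [h1, hmap, lintegral_map hmeas (by fun_prop)]
  simp only [enorm_mul, ENNReal.mul_rpow_of_nonneg _ _ hq0]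
  rw [lintegral_const_mul _ hmeas]
  push_cast
  rw [ENNReal.coe_toNNReal hfin, ENNReal.coe_rpow_of_nonneg _ hq0]
  gcongr
  rw [← Real.coe_sqrt, Real.enorm_of_nonneg (NNReal.coe_nonneg _), ENNReal.ofReal_coe_nnreal]
  exact_mod_cast NNReal.sqrt_le_sqrt.2 ht

lemma IsBrownianMotion.hasMomentBounds [IsProbabilityMeasure P] {d : ℕ} {W : ℝ≥0 → Ω → Space d}
    (hW : IsBrownianMotion W P) : HasMomentBounds P W := by
  have hi := fun i => hasMomentBounds_of_isBrownianReal (hW.coord i)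
  refine (HasMomentBounds.sum Finset.univ fun i _ => (hi i).norm).of_norm_le (fun t => ?_) ?_
    fun t ω => ?_
  · have : AEMeasurable (fun ω i => W t ω i) P :=
      aemeasurable_pi_lambda _ fun i => (hi i).aemeasurable t
    exact (PiLp.continuous_toLp 2 (fun _ : Fin d => ℝ)).measurable.comp_aemeasurable this
  · filter_upwards [ae_all_iff.2 fun i => (hi i).continuous_paths] with ω hω
    exact (PiLp.continuous_toLp 2 (fun _ : Fin d => ℝ)).comp (continuous_pi hω)
  · rw [Real.norm_of_nonneg (Finset.sum_nonneg fun _ _ => norm_nonneg _)]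
    rw [EuclideanSpace.norm_eq]
    refine Real.sqrt_le_iff.2 ⟨Finset.sum_nonneg fun _ _ => norm_nonneg _, ?_⟩
    exact Finset.sum_sq_le_sq_sum_of_nonneg fun _ _ => norm_nonneg _

/-- Subtracting `σ W` leaves a curve with a continuous velocity, to which the pathwise Gronwall
estimate applies; `σ W` is added back at the end. -/
lemma IsSolution.hasMomentBounds [IsProbabilityMeasure P] {d : ℕ} {W : ℝ≥0 → Ω → Space d}
    {σ : ℝ} {b : ℝ≥0 → Ω → Space d → Space d} {ξ : Ω → Space d} {X : ℝ≥0 → Ω → Space d}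
    (hX : IsSolution P W σ b ξ X) (hW : HasMomentBounds P W) (hξ : AEMeasurable ξ P)
    (hmom : ∀ q : ℝ, 2 ≤ q → ∫⁻ ω, ‖ξ ω‖ₑ ^ q ∂P < ⊤) {H : ℝ≥0 → Ω → ℝ}
    (hH : HasMomentBounds P H)
    (hb : ∀ᵐ ω ∂P, (Continuous fun t => X t ω) → (Continuous fun t => b t ω (X t ω)) ∧
      ∀ t, inner ℝ (X t ω - σ • W t ω) (b t ω (X t ω)) ≤
        ‖X t ω - σ • W t ω‖ ^ 2 + ‖X t ω - σ • W t ω‖ * ‖H t ω‖) :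
    HasMomentBounds P X := by
  have hσW := hW.const_smul σ
  have : HasMomentBounds P fun t ω => X t ω - σ • W t ω := by
    refine .of_inner_le (fun t => (hX.aemeasurable t).sub (hσW.aemeasurable t)) ?_ hξ hmom hH ?_
    · exact (hX.continuous_paths.and hσW.continuous_paths).mono fun _ h => h.1.sub h.2
    · filter_upwards [hX.continuous_paths, hX.integral_eq, hb] with ω hc hint hbω
      refine ⟨fun t => b t ω (X t ω), (hbω hc).1, fun t => ?_, (hbω hc).2⟩
      rw [sub_eq_iff_eq_add]
      exact hint t
  simpa using this.add hσW

end Processes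

/-! ### One-sided bounds for the drift, and moments of the coefficients. -/

section Drift

variable {d : ℕ}

/-- The drift `x - |x|^2 x`. -/
def drift (x : Space d) : Space d := x - ‖x‖ ^ 2 • x

lemma continuous_drift : Continuous (drift (d := d)) := by
  unfold drift; fun_prop

lemma neg_gradient_potential (x : Space d) : -gradient potential x = drift x := by
  have h2 : HasFDerivAt (fun x : Space d => ‖x‖ ^ 2) (2 • innerSL ℝ x) x :=
    (hasStrictFDerivAt_norm_sq x).hasFDerivAt
  have h4 := ((h2.pow 2).const_mul (1 / 4 : ℝ)).sub (h2.const_mul (1 / 2 : ℝ))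
  have hgrad : HasGradientAt potential (‖x‖ ^ 2 • x - x) x := by
    rw [hasGradientAt_iff_hasFDerivAt]
    have hpot : potential = (fun y : Space d => 1 / 4 * (‖y‖ ^ 2) ^ 2) -
        fun y => 1 / 2 * ‖y‖ ^ 2 := by
      funext y
      simp only [potential, Pi.sub_apply]
      ring
    rw [hpot]
    refine h4.congr_fderiv ?_
    ext y
    simp
    ring
  rw [hgrad.gradient, drift, neg_sub]

/-- The cubic part `|x|^2 x` is monotone, being the gradient of the convex function `|x|^4 / 4`, so
only the linear part of the drift contributes. -/
lemma inner_drift_add_sub_le (x u : Space d) :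
    inner ℝ u (drift (x + u) - drift x) ≤ ‖u‖ ^ 2 := by
  have e1 : inner ℝ u (drift (x + u) - drift x) =
      ‖u‖ ^ 2 - (‖x + u‖ ^ 2 * (inner ℝ x u + ‖u‖ ^ 2) - ‖x‖ ^ 2 * inner ℝ x u) := by
    simp only [drift, inner_sub_right, inner_add_right, inner_smul_right,
      real_inner_self_eq_norm_sq, real_inner_comm]
    ring
  have e2 : ‖x + u‖ ^ 2 = ‖x‖ ^ 2 + 2 * inner ℝ x u + ‖u‖ ^ 2 := norm_add_sq_real x u
  rw [e1, e2]
  -- The term subtracted from `|u|^2` is half of `|u|^2 |x+u|^2 + |u|^2 |x|^2 + (|x+u|^2 -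
  -- |x|^2)^2`.
  nlinarith [sq_nonneg (2 * inner ℝ x u + ‖u‖ ^ 2), sq_nonneg ‖u‖, sq_nonneg ‖x‖,
    mul_nonneg (sq_nonneg ‖u‖) (sq_nonneg ‖x‖), e2 ▸ mul_nonneg (sq_nonneg ‖u‖) (sq_nonneg ‖x + u‖)]

lemma norm_drift_add_sub_le (x z : Space d) :
    ‖drift (x + z) - drift x‖ ≤ ‖z‖ * (1 + 3 * (‖x‖ + ‖z‖) ^ 2) := by
  have e : drift (x + z) - drift x =
      z - (‖x + z‖ ^ 2 • z + ((‖x + z‖ - ‖x‖) * (‖x + z‖ + ‖x‖)) • x) := by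
    simp only [drift]; module
  have h1 := norm_add_le x z
  have h2 : |‖x + z‖ - ‖x‖| ≤ ‖z‖ := by simpa using abs_norm_sub_norm_le (x + z) x
  rw [e]
  calc _ ≤ ‖z‖ + (‖x + z‖ ^ 2 * ‖z‖ + |‖x + z‖ - ‖x‖| * (‖x + z‖ + ‖x‖) * ‖x‖) := by
        refine (norm_sub_le _ _).trans (add_le_add_right ((norm_add_le _ _).trans ?_) _)
        rw [norm_smul, norm_smul, norm_mul, norm_pow, norm_norm, Real.norm_eq_abs,
          Real.norm_of_nonneg (by positivity : 0 ≤ ‖x + z‖ + ‖x‖)]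
    _ ≤ ‖z‖ + ((‖x‖ + ‖z‖) ^ 2 * ‖z‖ + ‖z‖ * ((‖x‖ + ‖z‖) + (‖x‖ + ‖z‖)) * (‖x‖ + ‖z‖)) := by
        gcongr
        · linarith [norm_nonneg z]
        · linarith [norm_nonneg z]
    _ = _ := by ring

/-- The linearised cubic contributes `-|x|^2 |y|^2 - 2 ⟨x, y⟩^2`, so the bound is uniform in the
base point `x`. -/
lemma inner_linearDrift_le (x y : Space d) : inner ℝ y (linearDrift x y) ≤ ‖y‖ ^ 2 := by
  simp only [linearDrift, inner_sub_right, inner_smul_right, real_inner_self_eq_norm_sq,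
    real_inner_comm]
  nlinarith [mul_nonneg (sq_nonneg ‖x‖) (sq_nonneg ‖y‖), sq_nonneg (inner ℝ x y : ℝ),
    sq_nonneg (inner ℝ y x : ℝ)]

lemma linearDrift_add (x y z : Space d) :
    linearDrift x (y + z) = linearDrift x y + linearDrift x z := by
  simp only [linearDrift, inner_add_right]; module

/-- The other entries are positive, so each entry is below the sum. The forcing thus involves lower
orders only, which makes the system solvable by strong induction. -/
lemma tuples_two_mem {m : ℕ} {j : Fin 2 → ℕ} (hj : j ∈ tuples 2 m) (k : Fin 2) : j k < m := by
  simp only [tuples, Finset.mem_filter, Finset.Nat.mem_antidiagonalTuple, Fin.sum_univ_two,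
    Fin.forall_fin_two] at hj
  fin_cases k <;> simp <;> omega

lemma tuples_three_mem {m : ℕ} {j : Fin 3 → ℕ} (hj : j ∈ tuples 3 m) (k : Fin 3) : j k < m := by
  simp only [tuples, Finset.mem_filter, Finset.Nat.mem_antidiagonalTuple, Fin.sum_univ_three,
    Fin.forall_fin_succ] at hj
  simp at hj
  fin_cases k <;> simp <;> omega

variable {Ω : Type*} [MeasurableSpace Ω] {P : Measure Ω} [IsProbabilityMeasure P]

lemma hasMomentBounds_linearDrift {X Y : ℝ≥0 → Ω → Space d} (hX : HasMomentBounds P X)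
    (hY : HasMomentBounds P Y) : HasMomentBounds P fun t ω => linearDrift (X t ω) (Y t ω) := by
  have h := (hY.add ((hX.norm.mul hX.norm).smul hY |>.const_smul (-1))).add
    (((hX.inner hY).smul hX).const_smul (-2))
  convert h using 3 with t ω
  simp only [linearDrift]
  module

lemma hasMomentBounds_forcing {m : ℕ} (hm : 2 ≤ m) {X : ℕ → ℝ≥0 → Ω → Space d}
    (hX : ∀ k < m, HasMomentBounds P (X k)) :
    HasMomentBounds P fun t ω => forcing m fun i => X i t ω := by
  have h0 := hX 0 (by omega)
  have h2 := HasMomentBounds.sum (tuples 2 m) (H := fun j t ω =>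
    (inner ℝ (X (j 0) t ω) (X (j 1) t ω) : ℝ) • X 0 t ω +
      (2 : ℝ) • ((inner ℝ (X (j 0) t ω) (X 0 t ω) : ℝ) • X (j 1) t ω)) fun j hj =>
      have a := hX _ (tuples_two_mem hj 0)
      have b := hX _ (tuples_two_mem hj 1)
      ((a.inner b).smul h0).add (((a.inner h0).smul b).const_smul 2)
  have h3 := HasMomentBounds.sum (tuples 3 m) (H := fun j t ω =>
    (inner ℝ (X (j 0) t ω) (X (j 1) t ω) : ℝ) • X (j 2) t ω) fun j hj =>
      ((hX _ (tuples_three_mem hj 0)).inner (hX _ (tuples_three_mem hj 1))).smul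
        (hX _ (tuples_three_mem hj 2))
  convert (h2.const_smul (-1)).add (h3.const_smul (-1)) using 3 with t ω
  simp only [forcing, neg_smul, one_smul, smul_smul, sub_eq_add_neg]

omit [IsProbabilityMeasure P] in
lemma InitialExpansion.lintegral_lt_top {n : ℕ} {ξε : ℝ → Ω → Space d} {ξ : ℕ → Ω → Space d}
    (hξ : InitialExpansion P n ξε ξ) {k : ℕ} (hk : k ≤ n) (q : ℝ) (hq : 2 ≤ q) :
    ∫⁻ ω, ‖ξ k ω‖ₑ ^ q ∂P < ⊤ := by
  have h := hξ.moments k hk (q / 2) (by linarith)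
  rw [mul_div_cancel₀ q two_ne_zero] at h
  refine lt_of_eq_of_lt ?_ h.lintegral_lt_top
  simp only [enorm_rpow_eq_ofReal _ (by linarith : (0 : ℝ) ≤ q)]

lemma IsFluctuationSystem.hasMomentBounds {n : ℕ} {W : ℝ≥0 → Ω → Space d}
    (hW : HasMomentBounds P W) {ξε : ℝ → Ω → Space d} {ξ : ℕ → Ω → Space d}
    (hξ : InitialExpansion P n ξε ξ) {X : ℕ → ℝ≥0 → Ω → Space d}
    (hX : IsFluctuationSystem P W n ξ X) {m : ℕ} (hm : m ≤ n) : HasMomentBounds P (X m) := by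
  induction m using Nat.strong_induction_on with
  | _ m ih =>
    have hmeas := hξ.aemeasurable m hm
    have hmom := hξ.lintegral_lt_top hm
    match m, hm, ih with
    | 0, hm, ih =>
      refine hX.order_zero.hasMomentBounds hW hmeas hmom (.const (0 : ℝ))
        (Filter.Eventually.of_forall fun ω hc => ⟨continuous_drift.comp hc, fun t => ?_⟩)
      -- The monotonicity estimate at base point 0, where the drift vanishes.
      simpa [drift] using inner_drift_add_sub_le 0 (X 0 t ω)
    | 1, hm, ih =>
      have h0 := ih 0 one_pos (by omega)
      -- Once the noise is subtracted, linearity turns the linear drift evaluated at `√2 W` into a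
      -- forcing term.
      have hH := hasMomentBounds_linearDrift h0 (hW.const_smul √2)
      refine (hX.order_one hm).hasMomentBounds hW hmeas hmom hH.norm ?_
      filter_upwards [h0.continuous_paths] with ω h0c hc
      refine ⟨by unfold linearDrift; fun_prop, fun t => ?_⟩
      set y := X 1 t ω - √2 • W t ω with hy
      have : X 1 t ω = y + √2 • W t ω := by rw [hy, sub_add_cancel]
      rw [this, linearDrift_add, inner_add_right, norm_norm]
      exact add_le_add (inner_linearDrift_le _ _) (real_inner_le_norm _ _)
    | m + 2, hm, ih =>
      have h0 := ih 0 (by omega) (by omega)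
      have hH := hasMomentBounds_forcing (by omega) fun k (hk : k < m + 2) =>
        ih k hk (by omega)
      refine (hX.order_ge_two (m + 2) (by omega) hm).hasMomentBounds hW hmeas hmom hH.norm ?_
      filter_upwards [h0.continuous_paths, hH.continuous_paths] with ω h0c hFc hc
      refine ⟨Continuous.add (by unfold linearDrift; fun_prop) hFc, fun t => ?_⟩
      rw [zero_smul, sub_zero, inner_add_right, norm_norm]
      exact add_le_add (inner_linearDrift_le _ _) (real_inner_le_norm _ _)

end Drift

/-! ### Expansion of the drift in powers of `δ = √ε`. -/

section Algebra

/-- A sum over the triples of given positive sum, split according to the positions of the zeros. -/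
lemma sum_antidiagonalTuple_three {M : Type*} [AddCommMonoid M] {l : ℕ} (hl : 1 ≤ l)
    (f : (Fin 3 → ℕ) → M) :
    ∑ a ∈ Finset.Nat.antidiagonalTuple 3 l, f a =
      f ![0, 0, l] + f ![0, l, 0] + f ![l, 0, 0] +
      ∑ j ∈ tuples 2 l, (f ![0, j 0, j 1] + f ![j 0, 0, j 1] + f ![j 0, j 1, 0]) +
      ∑ j ∈ tuples 3 l, f j := by
  classical
  set A := Finset.Nat.antidiagonalTuple 3 l with hA
  have hmem : ∀ a, a ∈ A ↔ a 0 + a 1 + a 2 = l := fun a => by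
    simp [hA, Finset.Nat.mem_antidiagonalTuple, Fin.sum_univ_three]
  have hmem2 : ∀ j, j ∈ tuples 2 l ↔ j 0 + j 1 = l ∧ 0 < j 0 ∧ 0 < j 1 := fun j => by
    simp [tuples, Finset.Nat.mem_antidiagonalTuple, Fin.sum_univ_two, Fin.forall_fin_two]
  have hmem3 : ∀ j, j ∈ tuples 3 l ↔ j 0 + j 1 + j 2 = l ∧ 0 < j 0 ∧ 0 < j 1 ∧ 0 < j 2 :=
    fun j => by
      simp [tuples, Finset.Nat.mem_antidiagonalTuple, Fin.sum_univ_three, Fin.forall_fin_succ]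
  have hvec : ∀ a : Fin 3 → ℕ, ![a 0, a 1, a 2] = a := fun a => by
    ext i; fin_cases i <;> rfl
  have hvec2 : ∀ a : Fin 2 → ℕ, ![a 0, a 1] = a := fun a => by
    ext i; fin_cases i <;> rfl
  have one : ∀ b, b ∈ A → ∀ p : (Fin 3 → ℕ) → Prop, ∀ _ : DecidablePred p,
      (∀ a ∈ A, p a ↔ a = b) → ∑ a ∈ A with p a, f a = f b := fun b hb p _ h => by
    rw [Finset.filter_congr h, Finset.filter_eq', if_pos hb, Finset.sum_singleton]
  have split : ∀ (s : Finset (Fin 3 → ℕ)) (i : Fin 3),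
      ∑ a ∈ s, f a = ∑ a ∈ s with a i = 0, f a + ∑ a ∈ s with ¬ a i = 0, f a := fun s i =>
    (Finset.sum_filter_add_sum_filter_not s _ f).symm
  -- Eight zero patterns arise; the all-zero one is empty because `l ≥ 1`.
  rw [split A 0, split (A.filter fun a => a 0 = 0) 1, split (A.filter fun a => ¬ a 0 = 0) 1,
    split ((A.filter fun a => a 0 = 0).filter fun a => a 1 = 0) 2,
    split ((A.filter fun a => a 0 = 0).filter fun a => ¬ a 1 = 0) 2,
    split ((A.filter fun a => ¬ a 0 = 0).filter fun a => a 1 = 0) 2,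
    split ((A.filter fun a => ¬ a 0 = 0).filter fun a => ¬ a 1 = 0) 2]
  simp only [Finset.filter_filter]
  have e000 : ∑ a ∈ A with (a 0 = 0 ∧ a 1 = 0) ∧ a 2 = 0, f a = 0 := by
    rw [Finset.filter_false_of_mem, Finset.sum_empty]
    intro a ha; rw [hmem] at ha; omega
  have e001 : ∑ a ∈ A with (a 0 = 0 ∧ a 1 = 0) ∧ ¬ a 2 = 0, f a = f ![0, 0, l] := by
    refine one _ (by simp [hmem]) _ _ fun a ha => ?_
    rw [hmem] at ha
    rw [← hvec a]; simp; omega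
  have e010 : ∑ a ∈ A with (a 0 = 0 ∧ ¬ a 1 = 0) ∧ a 2 = 0, f a = f ![0, l, 0] := by
    refine one _ (by simp [hmem]) _ _ fun a ha => ?_
    rw [hmem] at ha
    rw [← hvec a]; simp; omega
  have e100 : ∑ a ∈ A with (¬ a 0 = 0 ∧ a 1 = 0) ∧ a 2 = 0, f a = f ![l, 0, 0] := by
    refine one _ (by simp [hmem]) _ _ fun a ha => ?_
    rw [hmem] at ha
    rw [← hvec a]; simp; omega
  have e011 : ∑ a ∈ A with (a 0 = 0 ∧ ¬ a 1 = 0) ∧ ¬ a 2 = 0, f a =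
      ∑ j ∈ tuples 2 l, f ![0, j 0, j 1] := by
    refine Finset.sum_nbij' (fun a => ![a 1, a 2]) (fun j => ![0, j 0, j 1]) ?_ ?_ ?_ ?_ ?_
    · intro a; simp [hmem, hmem2]; omega
    · intro a; simp [hmem, hmem2]; omega
    · intro a; simp only [Finset.mem_filter]; rintro ⟨-, ⟨h, -⟩, -⟩; simpa [h] using hvec a
    · intro j _; simpa using hvec2 j
    · intro a; simp only [Finset.mem_filter]; rintro ⟨-, ⟨h, -⟩, -⟩; nth_rw 1 [← hvec a]; simp [h]
  have e101 : ∑ a ∈ A with (¬ a 0 = 0 ∧ a 1 = 0) ∧ ¬ a 2 = 0, f a =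
      ∑ j ∈ tuples 2 l, f ![j 0, 0, j 1] := by
    refine Finset.sum_nbij' (fun a => ![a 0, a 2]) (fun j => ![j 0, 0, j 1]) ?_ ?_ ?_ ?_ ?_
    · intro a; simp [hmem, hmem2]; omega
    · intro a; simp [hmem, hmem2]; omega
    · intro a; simp only [Finset.mem_filter]; rintro ⟨-, ⟨-, h⟩, -⟩; simpa [h] using hvec a
    · intro j _; simpa using hvec2 j
    · intro a; simp only [Finset.mem_filter]; rintro ⟨-, ⟨-, h⟩, -⟩; nth_rw 1 [← hvec a]; simp [h]
  have e110 : ∑ a ∈ A with (¬ a 0 = 0 ∧ ¬ a 1 = 0) ∧ a 2 = 0, f a =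
      ∑ j ∈ tuples 2 l, f ![j 0, j 1, 0] := by
    refine Finset.sum_nbij' (fun a => ![a 0, a 1]) (fun j => ![j 0, j 1, 0]) ?_ ?_ ?_ ?_ ?_
    · intro a; simp [hmem, hmem2]; omega
    · intro a; simp [hmem, hmem2]; omega
    · intro a; simp only [Finset.mem_filter]; rintro ⟨-, -, h⟩; simpa [h] using hvec a
    · intro j _; simpa using hvec2 j
    · intro a; simp only [Finset.mem_filter]; rintro ⟨-, -, h⟩; nth_rw 1 [← hvec a]; simp [h]
  have e111 : ∑ a ∈ A with (¬ a 0 = 0 ∧ ¬ a 1 = 0) ∧ ¬ a 2 = 0, f a = ∑ j ∈ tuples 3 l, f j := by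
    refine Finset.sum_congr ?_ fun _ _ => rfl
    ext a; simp [hmem, hmem3]; omega
  rw [e000, e001, e010, e011, e100, e101, e110, e111, Finset.sum_add_distrib,
    Finset.sum_add_distrib]
  abel

variable {d : ℕ}

/-- The coefficient of `δ ^ l` in the drift of `∑ δ ^ k x_k`. -/
def coeffDrift (l : ℕ) (x : ℕ → Space d) : Space d :=
  x l - ∑ a ∈ Finset.Nat.antidiagonalTuple 3 l, (inner ℝ (x (a 0)) (x (a 1)) : ℝ) • x (a 2)

lemma coeffDrift_zero (x : ℕ → Space d) : coeffDrift 0 x = x 0 - ‖x 0‖ ^ 2 • x 0 := by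
  simp [coeffDrift, Finset.Nat.antidiagonalTuple_zero_right]

/-- Triples with two zeros give the cubic part of the linearised drift, those with one zero give the
pair sum, and those with none give the triple sum. Symmetry of the inner product merges two of the
three pair terms, whence the factor 2. -/
lemma coeffDrift_of_one_le {l : ℕ} (hl : 1 ≤ l) (x : ℕ → Space d) :
    coeffDrift l x = linearDrift (x 0) (x l) + forcing l x := by
  rw [coeffDrift, sum_antidiagonalTuple_three hl]
  have h2 : ∑ j ∈ tuples 2 l, ((inner ℝ (x 0) (x (j 0)) : ℝ) • x (j 1) +
      (inner ℝ (x (j 0)) (x 0) : ℝ) • x (j 1) + (inner ℝ (x (j 0)) (x (j 1)) : ℝ) • x 0) =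
      ∑ j ∈ tuples 2 l, ((inner ℝ (x (j 0)) (x (j 1)) : ℝ) • x 0 +
        (2 * inner ℝ (x (j 0)) (x 0) : ℝ) • x (j 1)) := by
    refine Finset.sum_congr rfl fun j _ => ?_
    rw [real_inner_comm (x (j 0)) (x 0)]
    module
  simp only [Matrix.cons_val_zero, Matrix.cons_val_one, Matrix.cons_val, h2, forcing, linearDrift,
    real_inner_self_eq_norm_sq, real_inner_comm (x 0) (x l)]
  module

lemma coeffDrift_one (x : ℕ → Space d) : coeffDrift 1 x = linearDrift (x 0) (x 1) := by
  have h2 : tuples 2 1 = ∅ := by decide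
  have h3 : tuples 3 1 = ∅ := by decide
  simp [coeffDrift_of_one_le le_rfl, forcing, h2, h3]

/-- The truncated expansion solves the drift equation up to the order `m`. -/
lemma norm_drift_sum_sub_le {δ : ℝ} (h0 : 0 ≤ δ) (h1 : δ ≤ 1) (m : ℕ) (x : ℕ → Space d) :
    ‖drift (∑ k ∈ Finset.range (m + 1), δ ^ k • x k) -
      ∑ l ∈ Finset.range (m + 1), δ ^ l • coeffDrift l x‖ ≤
      δ ^ (m + 1) * (∑ k ∈ Finset.range (m + 1), ‖x k‖) ^ 3 := by
  set R := Finset.range (m + 1) with hR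
  set S := ∑ k ∈ R, δ ^ k • x k with hS
  let c : ℕ × ℕ × ℕ → Space d := fun p =>
    δ ^ (p.1 + p.2.1 + p.2.2) • (inner ℝ (x p.1) (x p.2.1) : ℝ) • x p.2.2
  have hcube : ‖S‖ ^ 2 • S = ∑ p ∈ R ×ˢ R ×ˢ R, c p := by
    rw [Finset.sum_product]
    simp only [Finset.sum_product]
    rw [← real_inner_self_eq_norm_sq, hS, sum_inner, Finset.sum_smul]
    refine Finset.sum_congr rfl fun i _ => ?_
    rw [inner_sum, Finset.sum_smul]
    refine Finset.sum_congr rfl fun j _ => ?_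
    rw [Finset.smul_sum]
    refine Finset.sum_congr rfl fun k _ => ?_
    simp only [c, real_inner_smul_left, real_inner_smul_right, smul_smul]
    congr 1
    ring
  -- A triple with sum at most `m` automatically has entries at most `m`, so truncating the series
  -- loses none of these terms.
  have hlow : ∑ l ∈ R, δ ^ l • ∑ a ∈ Finset.Nat.antidiagonalTuple 3 l,
      (inner ℝ (x (a 0)) (x (a 1)) : ℝ) • x (a 2) =
      ∑ p ∈ R ×ˢ R ×ˢ R with p.1 + p.2.1 + p.2.2 ≤ m, c p := by
    simp only [Finset.smul_sum]
    rw [Finset.sum_sigma']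
    refine Finset.sum_bij' (fun z _ => (z.2 0, z.2 1, z.2 2))
      (fun p _ => ⟨p.1 + p.2.1 + p.2.2, ![p.1, p.2.1, p.2.2]⟩) ?_ ?_ ?_ ?_ ?_
    · rintro ⟨l, a⟩ h
      simp [hR, Finset.Nat.mem_antidiagonalTuple, Fin.sum_univ_three] at h ⊢
      omega
    · rintro ⟨i, j, k⟩ h
      simp [hR, Finset.Nat.mem_antidiagonalTuple, Fin.sum_univ_three] at h ⊢
      omega
    · rintro ⟨l, a⟩ h
      simp only [Finset.mem_sigma, Finset.Nat.mem_antidiagonalTuple, Fin.sum_univ_three] at h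
      obtain ⟨-, rfl⟩ := h
      congr 1
      ext i; fin_cases i <;> rfl
    · rintro ⟨i, j, k⟩ h
      rfl
    · rintro ⟨l, a⟩ h
      simp only [Finset.mem_sigma, Finset.Nat.mem_antidiagonalTuple, Fin.sum_univ_three] at h
      obtain ⟨-, rfl⟩ := h
      rfl
  have hdiff : drift S - ∑ l ∈ R, δ ^ l • coeffDrift l x =
      -∑ p ∈ R ×ˢ R ×ˢ R with ¬ p.1 + p.2.1 + p.2.2 ≤ m, c p := by
    simp only [drift, coeffDrift, smul_sub, Finset.sum_sub_distrib, hlow, hcube]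
    rw [← Finset.sum_filter_add_sum_filter_not (R ×ˢ R ×ˢ R)
      (fun p => p.1 + p.2.1 + p.2.2 ≤ m) c, ← hS]
    abel
  rw [hdiff, norm_neg]
  calc _ ≤ ∑ p ∈ R ×ˢ R ×ˢ R with ¬ p.1 + p.2.1 + p.2.2 ≤ m,
        δ ^ (m + 1) * (‖x p.1‖ * ‖x p.2.1‖ * ‖x p.2.2‖) := by
        refine (norm_sum_le _ _).trans (Finset.sum_le_sum fun p hp => ?_)
        simp only [c, norm_smul, norm_pow, Real.norm_of_nonneg h0]
        refine mul_le_mul ?_ ?_ (by positivity) (by positivity)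
        · exact pow_le_pow_of_le_one h0 h1 (by simp at hp; omega)
        · gcongr
          exact norm_inner_le_norm _ _
    -- Restoring the low-degree triples completes the sum to a perfect cube.
    _ ≤ ∑ p ∈ R ×ˢ R ×ˢ R, δ ^ (m + 1) * (‖x p.1‖ * ‖x p.2.1‖ * ‖x p.2.2‖) :=
        Finset.sum_le_sum_of_subset_of_nonneg (Finset.filter_subset _ _)
          fun _ _ _ => by positivity
    _ = _ := by
        rw [← Finset.mul_sum, Finset.sum_product]
        simp only [Finset.sum_product, ← Finset.mul_sum, ← Finset.sum_mul]
        ring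

lemma rpow_half_eq_sqrt_pow {ε : ℝ} (hε : 0 ≤ ε) (k : ℕ) : ε ^ ((k : ℝ) / 2) = √ε ^ k := by
  rw [Real.sqrt_eq_rpow, ← Real.rpow_natCast, ← Real.rpow_mul hε]
  congr 1; ring

end Algebra

/-! ### The equation for the remainder and its moments. -/

section Remainder

variable {Ω : Type*} [MeasurableSpace Ω] {P : Measure Ω} {d : ℕ}

/-- All the fluctuation equations in the common form given by `coeffDrift`. -/
lemma IsFluctuationSystem.integral_eq {n : ℕ} {W : ℝ≥0 → Ω → Space d}
    {ξ : ℕ → Ω → Space d} {X : ℕ → ℝ≥0 → Ω → Space d}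
    (hX : IsFluctuationSystem P W n ξ X) {l : ℕ} (hl : l ≤ n) :
    ∀ᵐ ω ∂P, ∀ t : ℝ≥0, X l t ω = ξ l ω +
      (∫ s in (0 : ℝ)..t, coeffDrift l fun i => X i s.toNNReal ω) +
      (if l = 1 then √2 else 0) • W t ω := by
  match l, hl with
  | 0, hl => simpa only [coeffDrift_zero, if_neg zero_ne_one] using hX.order_zero.integral_eq
  | 1, hl => simpa only [coeffDrift_one, if_true] using (hX.order_one hl).integral_eq
  | l + 2, hl =>
    have h := (hX.order_ge_two (l + 2) (by omega) hl).integral_eq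
    simpa only [coeffDrift_of_one_le (by omega : 1 ≤ l + 2), if_neg (by omega : ¬ l + 2 = 1)]
      using h

lemma continuous_coeffDrift {n l : ℕ} (hl : l ≤ n) {x : ℝ≥0 → ℕ → Space d}
    (hx : ∀ k ≤ n, Continuous fun t => x t k) : Continuous fun t => coeffDrift l (x t) := by
  refine (hx l hl).sub (continuous_finsetSum _ fun a ha => ?_)
  rw [Finset.Nat.mem_antidiagonalTuple, Fin.sum_univ_three] at ha
  exact (Continuous.inner (𝕜 := ℝ) (hx (a 0) (by omega)) (hx (a 1) (by omega))).smul
    (hx (a 2) (by omega))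

lemma partialSum_eq {ε : ℝ} (hε : 0 ≤ ε) (m : ℕ) (x : ℕ → Space d) :
    partialSum ε m x = ∑ k ∈ Finset.range (m + 1), √ε ^ k • x k := by
  simp only [partialSum, rpow_half_eq_sqrt_pow hε]

/-- The truncated expansion solves an integral equation; its noise is that of `X ε` if the order is
positive. -/
lemma IsFluctuationSystem.partialSum_integral_eq {n : ℕ} {W : ℝ≥0 → Ω → Space d}
    {ξ : ℕ → Ω → Space d} {X : ℕ → ℝ≥0 → Ω → Space d}
    (hX : IsFluctuationSystem P W n ξ X)
    (hXc : ∀ᵐ ω ∂P, ∀ k ≤ n, Continuous fun t => X k t ω) {m : ℕ} (hm : m ≤ n) :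
    ∀ᵐ ω ∂P, ∀ ε, 0 ≤ ε → ∀ t : ℝ≥0, partialSum ε m (fun k => X k t ω) =
      partialSum ε m (fun k => ξ k ω) +
      (∫ s in (0 : ℝ)..t, partialSum ε m fun l => coeffDrift l fun i => X i s.toNNReal ω) +
      (if m = 0 then 0 else √(2 * ε)) • W t ω := by
  have hall : ∀ᵐ ω ∂P, ∀ l : Finset.range (m + 1), ∀ t : ℝ≥0, X l t ω = ξ l ω +
      (∫ s in (0 : ℝ)..t, coeffDrift l fun i => X i s.toNNReal ω) +
      (if (l : ℕ) = 1 then √2 else 0) • W t ω :=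
    ae_all_iff.2 fun l => hX.integral_eq (by have := Finset.mem_range.1 l.2; omega)
  filter_upwards [hall, hXc] with ω hω hc ε hε t
  have hint : ∀ l ∈ Finset.range (m + 1), IntervalIntegrable
      (fun s : ℝ => √ε ^ l • coeffDrift l fun i => X i s.toNNReal ω) volume 0 t := fun l hl => by
    have hl' : l ≤ n := by have := Finset.mem_range.1 hl; omega
    have hcont := (continuous_coeffDrift hl' (x := fun t k => X k t ω) hc).comp
      continuous_real_toNNReal
    exact (hcont.const_smul (√ε ^ l)).intervalIntegrable _ _
  simp only [partialSum_eq hε]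
  rw [intervalIntegral.integral_finsetSum hint, ← Finset.sum_add_distrib]
  -- Only the coefficient of order 1 carries noise, and `√ε * √2 = √(2 * ε)`.
  have hnoise : (if m = 0 then 0 else √(2 * ε)) • W t ω =
      ∑ k ∈ Finset.range (m + 1), √ε ^ k • (if k = 1 then √2 else 0 : ℝ) • W t ω := by
    by_cases h0 : m = 0
    · simp [h0]
    · rw [Finset.sum_eq_single 1, if_neg h0, if_pos rfl, smul_smul, pow_one, mul_comm,
        Real.sqrt_mul hε]
      · intro k _ hk; simp [hk]
      · intro h; exact absurd (Finset.mem_range.2 (by omega)) h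
  rw [hnoise, ← Finset.sum_add_distrib]
  refine Finset.sum_congr rfl fun k hk => ?_
  rw [intervalIntegral.integral_smul, ← smul_add, ← smul_add]
  exact congrArg _ (hω ⟨k, hk⟩ t)

/-- The bound for the residual of the truncated expansion, relative to `ε ^ ((m + 1) / 2)`: here
`N` bounds the coefficients and `w` the noise. -/
def residualBound (N w : ℝ) : ℝ := 2 * w * (1 + 3 * ((N + 2 * w) * (N + 2 * w))) + N * (N * N)

/-- Passing from `S + τ w + u` to `S + τ w` uses monotonicity, so the bound stays linear in `|u|`
beyond `|u|^2`. Passing on to `S` uses the local Lipschitz bound with `|τ w| ≤ 2 δ^(m+1) |w|`, and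
the last gap is the truncation defect. -/
lemma inner_drift_sub_le {δ τ : ℝ} (h0 : 0 ≤ δ) (h1 : δ ≤ 1) {m : ℕ} (hτ0 : 0 ≤ τ)
    (hτ : τ ≤ 2 * δ ^ (m + 1)) (x : ℕ → Space d) (u w : Space d) :
    inner ℝ u (drift (∑ k ∈ Finset.range (m + 1), δ ^ k • x k + τ • w + u) -
      ∑ l ∈ Finset.range (m + 1), δ ^ l • coeffDrift l x) ≤
      ‖u‖ ^ 2 + ‖u‖ * (δ ^ (m + 1) *
        residualBound (∑ k ∈ Finset.range (m + 1), ‖x k‖) ‖w‖) := by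
  set S := ∑ k ∈ Finset.range (m + 1), δ ^ k • x k with hS
  set D := ∑ l ∈ Finset.range (m + 1), δ ^ l • coeffDrift l x with hD
  set N := ∑ k ∈ Finset.range (m + 1), ‖x k‖ with hN
  have hSN : ‖S‖ ≤ N := by
    refine (norm_sum_le _ _).trans (Finset.sum_le_sum fun k _ => ?_)
    rw [norm_smul, norm_pow, Real.norm_of_nonneg h0]
    exact mul_le_of_le_one_left (norm_nonneg _) (pow_le_one₀ h0 h1)
  have hδ1 : δ ^ (m + 1) ≤ 1 := pow_le_one₀ h0 h1
  have hz : ‖τ • w‖ ≤ δ ^ (m + 1) * (2 * ‖w‖) := by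
    rw [norm_smul, Real.norm_of_nonneg hτ0]
    nlinarith [norm_nonneg w]
  have hz' : ‖τ • w‖ ≤ 2 * ‖w‖ :=
    hz.trans (mul_le_of_le_one_left (by positivity) hδ1)
  have e : drift (S + τ • w + u) - D = (drift (S + τ • w + u) - drift (S + τ • w)) +
      ((drift (S + τ • w) - drift S) + (drift S - D)) := by abel
  have h3 : ‖(drift (S + τ • w) - drift S) + (drift S - D)‖ ≤
      δ ^ (m + 1) * residualBound N ‖w‖ := by
    refine (norm_add_le _ _).trans ?_
    have a1 := norm_drift_add_sub_le S (τ • w)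
    have a2 := norm_drift_sum_sub_le h0 h1 m x
    have a3 : ‖τ • w‖ * (1 + 3 * (‖S‖ + ‖τ • w‖) ^ 2) ≤
        δ ^ (m + 1) * (2 * ‖w‖) * (1 + 3 * (N + 2 * ‖w‖) ^ 2) := by gcongr
    calc _ ≤ δ ^ (m + 1) * (2 * ‖w‖) * (1 + 3 * (N + 2 * ‖w‖) ^ 2) + δ ^ (m + 1) * N ^ 3 :=
          add_le_add (a1.trans a3) a2
      _ = _ := by rw [residualBound]; ring
  rw [e, inner_add_right]
  refine add_le_add (inner_drift_add_sub_le _ _) ((real_inner_le_norm _ _).trans ?_)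
  gcongr

lemma hasMomentBounds_residualBound [IsProbabilityMeasure P] {m : ℕ} {W : ℝ≥0 → Ω → Space d}
    (hW : HasMomentBounds P W) {X : ℕ → ℝ≥0 → Ω → Space d}
    (hX : ∀ k ≤ m, HasMomentBounds P (X k)) :
    HasMomentBounds P fun t ω =>
      residualBound (∑ k ∈ Finset.range (m + 1), ‖X k t ω‖) ‖W t ω‖ := by
  have hN := HasMomentBounds.sum (Finset.range (m + 1)) (H := fun k t ω => ‖X k t ω‖)
    fun k hk => (hX k (by have := Finset.mem_range.1 hk; omega)).norm
  have h2w := (HasMomentBounds.const (P := P) (2 : ℝ)).mul hW.norm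
  have hs := hN.add h2w
  exact (h2w.mul ((HasMomentBounds.const (1 : ℝ)).add
    ((HasMomentBounds.const (3 : ℝ)).mul (hs.mul hs)))).add (hN.mul (hN.mul hN))

lemma lintegral_rpow_le_of_momentLE {Y : Ω → Space d} {q B : ℝ} (hq : 0 ≤ q)
    (h : MomentLE P Y q B) : ∫⁻ ω, ‖Y ω‖ₑ ^ q ∂P ≤ ENNReal.ofReal B := by
  simp only [enorm_rpow_eq_ofReal _ hq]
  rw [← ofReal_integral_eq_lintegral_ofReal h.1
    (Filter.Eventually.of_forall fun ω => by positivity)]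
  exact ENNReal.ofReal_le_ofReal h.2

lemma momentLE_of_lintegral_rpow_le {Y : Ω → Space d} {q B : ℝ} (hq : 0 ≤ q) (hB : 0 ≤ B)
    (hY : AEMeasurable Y P) (h : ∫⁻ ω, ‖Y ω‖ₑ ^ q ∂P ≤ ENNReal.ofReal B) : MomentLE P Y q B := by
  simp only [enorm_rpow_eq_ofReal _ hq] at h
  have hm : AEStronglyMeasurable (fun ω => ‖Y ω‖ ^ q) P :=
    (hY.norm.pow_const q).aestronglyMeasurable
  have h0 : 0 ≤ᵐ[P] fun ω => ‖Y ω‖ ^ q := Filter.Eventually.of_forall fun ω => by positivity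
  have hi : Integrable (fun ω => ‖Y ω‖ ^ q) P :=
    ⟨hm, (hasFiniteIntegral_iff_ofReal h0).2 (h.trans_lt ENNReal.ofReal_lt_top)⟩
  refine ⟨hi, ?_⟩
  rwa [← ofReal_integral_eq_lintegral_ofReal hi h0, ENNReal.ofReal_le_ofReal_iff hB] at h

lemma lintegral_enorm_add_rpow_le {Y Z : Ω → Space d} (hY : AEMeasurable Y P) {q : ℝ}
    (hq : 1 ≤ q) : ∫⁻ ω, ‖Y ω + Z ω‖ₑ ^ q ∂P ≤
      (2 : ENNReal) ^ (q - 1) * ((∫⁻ ω, ‖Y ω‖ₑ ^ q ∂P) + ∫⁻ ω, ‖Z ω‖ₑ ^ q ∂P) := by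
  have h2 : (2 : ENNReal) ^ (q - 1) ≠ ⊤ := ENNReal.rpow_ne_top_of_nonneg (by linarith) (by simp)
  rw [← lintegral_add_left' (hY.enorm.pow_const q), ← lintegral_const_mul' _ _ h2]
  exact lintegral_mono fun ω => (ENNReal.rpow_le_rpow (enorm_add_le _ _) (by linarith)).trans
    (ENNReal.rpow_add_le_mul_rpow_add_rpow _ _ hq)

lemma lintegral_enorm_smul_rpow {E : Type*} [NormedAddCommGroup E] [NormedSpace ℝ E] {c : ℝ}
    (hc : 0 ≤ c) (Y : Ω → E) {q : ℝ} (hq : 0 ≤ q) :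
    ∫⁻ ω, ‖c • Y ω‖ₑ ^ q ∂P = ENNReal.ofReal (c ^ q) * ∫⁻ ω, ‖Y ω‖ₑ ^ q ∂P := by
  simp only [enorm_smul, ENNReal.mul_rpow_of_nonneg _ _ hq]
  rw [enorm_rpow_eq_ofReal _ hq, lintegral_const_mul' _ _ ENNReal.ofReal_ne_top,
    Real.norm_of_nonneg hc]

variable [IsProbabilityMeasure P] {n : ℕ} {W : ℝ≥0 → Ω → Space d}
  {ξε : ℝ → Ω → Space d} {ξ : ℕ → Ω → Space d} {X : ℝ → ℝ≥0 → Ω → Space d}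
  {Xbar : ℕ → ℝ≥0 → Ω → Space d}

/-- The moments of `X ε - ∑_{k ≤ m} ε^{k/2} X̄_k` are of the order predicted by the expansion. -/
lemma exists_lintegral_sub_partialSum_le (hW : HasMomentBounds P W)
    (hξε_meas : ∀ ε ∈ Set.Ioo (0 : ℝ) 1, AEMeasurable (ξε ε) P)
    (hξ : InitialExpansion P n ξε ξ)
    (hX : ∀ ε ∈ Set.Ioo (0 : ℝ) 1, IsLangevinSolution P W ε (ξε ε) (X ε))
    (hXbar : IsFluctuationSystem P W n ξ Xbar) {m : ℕ} (hm : m ≤ n) {p : ℝ} (hp : 1 ≤ p)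
    (T : ℝ≥0) : ∃ C : ENNReal, C ≠ ⊤ ∧ ∀ ε ∈ Set.Ioo (0 : ℝ) 1, ∀ t ≤ T,
      ∫⁻ ω, ‖X ε t ω - partialSum ε m (fun k => Xbar k t ω)‖ₑ ^ (2 * p) ∂P ≤
        C * ENNReal.ofReal (ε ^ (((m : ℝ) + 1) * p)) := by
  have hXb : ∀ k ≤ n, HasMomentBounds P (Xbar k) := fun k hk =>
    hXbar.hasMomentBounds hW hξ hk
  have hXbc : ∀ᵐ ω ∂P, ∀ k ≤ n, Continuous fun t => Xbar k t ω :=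
    ae_all_iff.2 fun k => by
      by_cases hk : k ≤ n
      · exact (hXb k hk).continuous_paths.mono fun _ h _ => h
      · exact Filter.Eventually.of_forall fun _ h => absurd h hk
  have hq : (2 : ℝ) ≤ 2 * p := by linarith
  have hq0 : (0 : ℝ) ≤ 2 * p := by linarith
  set H : ℝ≥0 → Ω → ℝ := fun t ω =>
    residualBound (∑ k ∈ Finset.range (m + 1), ‖Xbar k t ω‖) ‖W t ω‖ with hHdef
  have hH : HasMomentBounds P H :=
    hasMomentBounds_residualBound hW fun k hk => hXb k (hk.trans hm)
  obtain ⟨B, hB⟩ := hH.moments _ hq T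
  obtain ⟨A, hA⟩ := hξ.remainder m hm p hp
  obtain ⟨Cw, hCw⟩ := hW.moments _ hq T
  -- The Gronwall bound for `u` plus the moment of `τ W`, joined by convexity of the power; the
  -- common factor `ε^((m+1)p)` is taken out.
  refine ⟨(2 : ENNReal) ^ (2 * p - 1) * (ENNReal.ofReal (Real.exp (2 * (2 * p) * T)) *
    (ENNReal.ofReal A + ENNReal.ofReal (2 * p) * (T * B)) + ENNReal.ofReal (2 ^ (2 * p)) * Cw),
    ?_, fun ε hε t ht => ?_⟩
  · have : (2 : ENNReal) ^ (2 * p - 1) ≠ ⊤ :=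
      ENNReal.rpow_ne_top_of_nonneg (by linarith) (by simp)
    finiteness
  set δ := √ε with hδ
  have hδ0 : 0 ≤ δ := Real.sqrt_nonneg _
  have hδ1 : δ ≤ 1 := Real.sqrt_le_one.2 hε.2.le
  have hpow : (δ ^ (m + 1)) ^ (2 * p) = ε ^ (((m : ℝ) + 1) * p) := by
    rw [← rpow_half_eq_sqrt_pow hε.1.le, ← Real.rpow_mul hε.1.le]
    congr 1; push_cast; ring
  set R := ENNReal.ofReal (ε ^ (((m : ℝ) + 1) * p)) with hR
  -- For `m = 0` the expansion carries no noise, so that of `X ε` must be removed separately; its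
  -- size `√(2ε)` is already of order `δ^(m+1)`.
  set τ : ℝ := if m = 0 then √(2 * ε) else 0 with hτ
  have hτ0 : 0 ≤ τ := by rw [hτ]; split_ifs <;> positivity
  have hτ1 : τ ≤ 2 * δ ^ (m + 1) := by
    rw [hτ]
    split_ifs with h
    · rw [h, zero_add, pow_one, Real.sqrt_mul (by norm_num)]
      gcongr
      exact Real.sqrt_le_iff.2 ⟨by norm_num, by norm_num⟩
    · positivity
  have hSm : ∀ (Y : ℕ → Ω → Space d), (∀ k ≤ n, AEMeasurable (Y k) P) →
      AEMeasurable (fun ω => partialSum ε m fun k => Y k ω) P := fun Y hY =>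
    Finset.aemeasurable_fun_sum _ fun k hk =>
      (hY k (by have := Finset.mem_range.1 hk; omega)).const_smul (ε ^ ((k : ℝ) / 2))
  have hXm := (hX ε hε).aemeasurable t
  set u : ℝ≥0 → Ω → Space d := fun t ω =>
    X ε t ω - partialSum ε m (fun k => Xbar k t ω) - τ • W t ω with hu
  have hum : AEMeasurable (u t) P :=
    (hXm.sub (hSm (fun k => Xbar k t) fun k hk => (hXb k hk).aemeasurable t)).sub
      ((hW.aemeasurable t).const_smul τ)
  have hu0m : AEMeasurable (fun ω => ξε ε ω - partialSum ε m fun k => ξ k ω) P :=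
    (hξε_meas ε hε).sub (hSm ξ hξ.aemeasurable)
  have hHδ := hH.const_smul (δ ^ (m + 1))
  have hBδ : ∀ s ≤ T, ∫⁻ ω, ‖δ ^ (m + 1) • H s ω‖ₑ ^ (2 * p) ∂P ≤ R * B := fun s hs => by
    rw [lintegral_enorm_smul_rpow (by positivity) _ hq0, hpow]
    gcongr
    exact hB s hs
  have hA' : ∫⁻ ω, ‖ξε ε ω - partialSum ε m fun k => ξ k ω‖ₑ ^ (2 * p) ∂P ≤
      ENNReal.ofReal A * R :=
    (lintegral_rpow_le_of_momentLE hq0 (hA ε hε)).trans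
      (ENNReal.ofReal_mul' (Real.rpow_nonneg hε.1.le _)).le
  have hmain := lintegral_enorm_rpow_le_of_inner_le (u := u) hu0m hHδ.aemeasurable
    hHδ.continuous_paths ?_ hq hA' hBδ ht
  · have hdecomp : ∀ ω, X ε t ω - partialSum ε m (fun k => Xbar k t ω) = u t ω + τ • W t ω :=
      fun ω => (sub_add_cancel _ _).symm
    simp only [hdecomp]
    have hτW : ∫⁻ ω, ‖τ • W t ω‖ₑ ^ (2 * p) ∂P ≤ ENNReal.ofReal (2 ^ (2 * p)) * R * Cw := by
      rw [lintegral_enorm_smul_rpow hτ0 _ hq0, hR, ← ENNReal.ofReal_mul (by positivity), ← hpow,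
        ← Real.mul_rpow (by norm_num) (by positivity)]
      gcongr
      exact hCw t ht
    calc _ ≤ _ := lintegral_enorm_add_rpow_le hum (by linarith)
      _ ≤ _ := mul_le_mul_right (add_le_add hmain hτW) _
      _ = _ := by ring
  · filter_upwards [(hX ε hε).continuous_paths, (hX ε hε).integral_eq, hXbc,
      hXbar.partialSum_integral_eq hXbc hm] with ω hXc hXi hbc hbi
    have hg1 : Continuous fun t => drift (X ε t ω) := continuous_drift.comp hXc
    have hg2 : Continuous fun t =>
        partialSum ε m fun l => coeffDrift l fun i => Xbar i t ω :=
      continuous_finsetSum _ fun k hk => (continuous_coeffDrift (l := k) (n := n)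
        (by have := Finset.mem_range.1 hk; omega) (x := fun t k => Xbar k t ω) hbc).const_smul
          (ε ^ ((k : ℝ) / 2))
    refine ⟨fun t => drift (X ε t ω) - partialSum ε m fun l => coeffDrift l fun i => Xbar i t ω,
      hg1.sub hg2, fun t => ?_, fun t => ?_⟩
    · have hsub : ∫ s in (0 : ℝ)..t, (drift (X ε s.toNNReal ω) -
          partialSum ε m fun l => coeffDrift l fun i => Xbar i s.toNNReal ω) =
          (∫ s in (0 : ℝ)..t, drift (X ε s.toNNReal ω)) -
          ∫ s in (0 : ℝ)..t, partialSum ε m fun l => coeffDrift l fun i => Xbar i s.toNNReal ω :=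
        intervalIntegral.integral_sub
          ((hg1.comp continuous_real_toNNReal).intervalIntegrable _ _)
          ((hg2.comp continuous_real_toNNReal).intervalIntegrable _ _)
      simp only [hu]
      rw [hsub]
      rw [hXi t, hbi ε hε.1.le t]
      simp only [neg_gradient_potential, hτ]
      split_ifs <;> module
    · have hx : X ε t ω = partialSum ε m (fun k => Xbar k t ω) + τ • W t ω + u t ω := by
        simp only [hu]; abel
      beta_reduce
      rw [hx]
      simp only [partialSum_eq hε.1.le]
      refine (inner_drift_sub_le hδ0 hδ1 hτ0 hτ1 _ _ _).trans ?_
      gcongr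
      exact Real.le_norm_self _

lemma exists_momentLE_remainder (hW : HasMomentBounds P W)
    (hξε_meas : ∀ ε ∈ Set.Ioo (0 : ℝ) 1, AEMeasurable (ξε ε) P)
    (hξ : InitialExpansion P n ξε ξ)
    (hX : ∀ ε ∈ Set.Ioo (0 : ℝ) 1, IsLangevinSolution P W ε (ξε ε) (X ε))
    (hXbar : IsFluctuationSystem P W n ξ Xbar) {p : ℝ} (hp : 1 ≤ p) (T : ℝ≥0) :
    ∃ C : ℝ, 0 < C ∧ ∀ ε ∈ Set.Ioo (0 : ℝ) 1, ∀ m ≤ n, ∀ t ≤ T,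
      MomentLE P (remainder X Xbar ε m t) (2 * p) (C * ε ^ p) := by
  choose! C hCtop hC using fun m (hm : m ≤ n) =>
    exists_lintegral_sub_partialSum_le hW hξε_meas hξ hX hXbar hm hp T
  -- Summing over the finitely many orders makes the constant uniform in `m`; the 1 makes it
  -- positive.
  refine ⟨1 + ∑ m ∈ Finset.range (n + 1), (C m).toReal,
    by positivity, fun ε hε m hm t ht => ?_⟩
  have hq0 : (0 : ℝ) ≤ 2 * p := by linarith
  have hεp : 0 ≤ ε ^ p := Real.rpow_nonneg hε.1.le _
  refine momentLE_of_lintegral_rpow_le hq0 (by positivity) ?_ ?_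
  · refine (((hX ε hε).aemeasurable t).sub (Finset.aemeasurable_fun_sum _
      fun k hk => ?_)).const_smul (ε ^ ((m : ℝ) / 2))⁻¹
    exact ((hXbar.hasMomentBounds hW hξ
      (by have := Finset.mem_range.1 hk; omega)).aemeasurable t).const_smul (ε ^ ((k : ℝ) / 2))
  · simp only [remainder]
    have hε0 := hε.1.le
    rw [lintegral_enorm_smul_rpow (by positivity) _ hq0]
    have hle : C m ≤ ENNReal.ofReal (1 + ∑ m ∈ Finset.range (n + 1), (C m).toReal) := by
      rw [← ENNReal.ofReal_toReal (hCtop m hm)]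
      refine ENNReal.ofReal_le_ofReal ?_
      have := Finset.single_le_sum (f := fun m => (C m).toReal) (fun _ _ => ENNReal.toReal_nonneg)
        (Finset.mem_range.2 (Nat.lt_succ_of_le hm))
      linarith
    have hpow : ((ε ^ ((m : ℝ) / 2))⁻¹) ^ (2 * p) * ε ^ (((m : ℝ) + 1) * p) = ε ^ p := by
      rw [← Real.rpow_neg hε0, ← Real.rpow_mul hε0, ← Real.rpow_add hε.1]
      congr 1; ring
    calc _ ≤ ENNReal.ofReal (((ε ^ ((m : ℝ) / 2))⁻¹) ^ (2 * p)) *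
          (C m * ENNReal.ofReal (ε ^ (((m : ℝ) + 1) * p))) := by
          gcongr
          exact hC m hm ε hε t ht
      _ = C m * ENNReal.ofReal (ε ^ p) := by
          rw [← hpow, ENNReal.ofReal_mul (by positivity)]
          ring
      _ ≤ _ := by
          rw [ENNReal.ofReal_mul (by positivity)]
          gcongr

end Remainder

end DoubleWell

end

theorem proposition1p1 {Ω : Type*} [MeasurableSpace Ω] (P : Measure Ω) [IsProbabilityMeasure P]
    (d n : ℕ)
    (W : ℝ≥0 → Ω → DoubleWell.Space d) (hW : DoubleWell.IsBrownianMotion W P)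
    (ξε : ℝ → Ω → DoubleWell.Space d)
    (hξε_meas : ∀ ε ∈ Set.Ioo (0 : ℝ) 1, AEMeasurable (ξε ε) P)
    (hξε_indep : ∀ ε ∈ Set.Ioo (0 : ℝ) 1, IndepFun (ξε ε) (fun ω t => W t ω) P)
    (ξ : ℕ → Ω → DoubleWell.Space d) (hξ : DoubleWell.InitialExpansion P n ξε ξ)
    (X : ℝ → ℝ≥0 → Ω → DoubleWell.Space d)
    (hX : ∀ ε ∈ Set.Ioo (0 : ℝ) 1, DoubleWell.IsLangevinSolution P W ε (ξε ε) (X ε))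
    (Xbar : ℕ → ℝ≥0 → Ω → DoubleWell.Space d)
    (hXbar : DoubleWell.IsFluctuationSystem P W n ξ Xbar) :
    (∀ p : ℝ, 1 ≤ p → ∀ t : ℝ≥0, 0 < t → ∃ C : ℝ, 0 < C ∧
      ∀ ε ∈ Set.Ioo (0 : ℝ) 1, ∀ m ≤ n,
        DoubleWell.MomentLE P (DoubleWell.remainder X Xbar ε m t) (2 * p) (C * ε ^ p)) ∧
    (∀ p : ℝ, 1 ≤ p → ∀ T : ℝ≥0, 0 < T → ∃ C : ℝ, 0 < C ∧
      ∀ ε ∈ Set.Ioo (0 : ℝ) 1, ∀ m ≤ n, ∀ t ≤ T,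
        DoubleWell.MomentLE P (DoubleWell.remainder X Xbar ε m t) (2 * p) (C * ε ^ p)) := by
  have hmain := fun (p : ℝ) (hp : 1 ≤ p) (T : ℝ≥0) =>
    DoubleWell.exists_momentLE_remainder hW.hasMomentBounds hξε_meas hξ hX hXbar hp T
  refine ⟨fun p hp t _ => ?_, fun p hp T _ => hmain p hp T⟩
  -- The fixed-time claim is the uniform one on `[0, t]`, read at its endpoint.
  obtain ⟨C, hC, h⟩ := hmain p hp t
  exact ⟨C, hC, fun ε hε m hm => h ε hε m hm t le_rfl⟩
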